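/- **Setting.** Candidates $t=1,\dots,T$ arrive sequentially with i.i.d. abilities $\theta_1,\dots,\theta_T$ drawn from a distribution with cumulative distribution function $F$ supported in $[0,1]$; each must be irrevocably hired or rejected on arrival, and at most $B\in\{1,\dots,T\}$ may be hired. The certainty-equivalent (CE) policy starts with $B_0=B$ and, for $t=1,\dots,T$, sets $p_{t-1}=1-\frac{B_{t-1}}{T-t+1}$, hires candidate $t$ (and sets $\mu_t=1$, $B_t=B_{t-1}-1$) if $F(\theta_t)\ge p_{t-1}$, and otherwise rejects (and sets $\mu_t=0$, $B_t=B_{t-1}$). Its regret is $$\mathrm{Regret}(B,T;\mathrm{CE})=\mathbb E\Big[\max_{S\subseteq\{1,\dots,T\},\,|S|\le B}\ \sum_{t\in S}\theta_t\Big]-\mathbb E\Big[\sum_{t=1}^T\theta_t\mu_t\Big].$$ **Theorem 1 (Failure of the CE policy).** For every $\varepsilon\in(0,1/2]$ there is $T_0=T_0(\varepsilon)<\infty$, and for every $\eta\in(0,1)$ there is a constant $C=C(\eta,\varepsilon)>0$, such that the following holds. Let $F$ be any non-atomic distribution supported in $[0,1]$ that has a gap of length at least $\eta$ with mass at least $\varepsilon$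 on each side, i.e. there is $c\in(0,1-\eta)$ with $F(c)=F((c+\eta)^-)$ and $\min\{F(c),\,1-F(c+\eta)\}\ge\varepsilon$. Then for every $T\ge T_0$ there is a budget $B\in\{1,\dots,T\}$ such that $$\mathrm{Regret}(B,T;\mathrm{CE})\ \ge\ C\sqrt T .$$ -/

import Mathlib

open MeasureTheory ProbabilityTheory

namespace MultiSecretary

noncomputable section

/-- The law of an i.i.d. sequence of candidate abilities with common distribution `μ`.
Candidates are indexed from `0`, so with horizon `T` the abilities are `θ 0, …, θ (T - 1)`. -/
def abilityLaw (μ : Measure ℝ) [IsProbabilityMeasure μ] : Measure (ℕ → ℝ) :=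
  Measure.infinitePi (fun _ : ℕ => μ)

/-- The offline (hindsight) value of a realization: the largest total ability of a set of at most
`B` of the first `T` candidates. -/
def offlineReward (B T : ℕ) (θ : ℕ → ℝ) : ℝ :=
  ((Finset.range T).powerset.filter (fun S => S.card ≤ B)).sup' ⟨∅, by simp⟩
    (fun S => ∑ t ∈ S, θ t)

/-- The expected offline value. -/
def offlineValue (μ : Measure ℝ) [IsProbabilityMeasure μ] (B T : ℕ) : ℝ :=
  ∫ θ, offlineReward B T θ ∂(abilityLaw μ)

/-- The expected total ability hired over horizon `T` by a policy, given by its hiring decisions: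
`hire θ t` is `1` if candidate `t` is hired on the realization `θ`, and `0` otherwise. -/
def policyValue (μ : Measure ℝ) [IsProbabilityMeasure μ] (T : ℕ)
    (hire : (ℕ → ℝ) → ℕ → ℤ) : ℝ :=
  ∫ θ, ∑ t ∈ Finset.range T, θ t * (hire θ t : ℝ) ∂(abilityLaw μ)

/-- The expected regret of a policy against the offline benchmark. -/
def regret (μ : Measure ℝ) [IsProbabilityMeasure μ] (B T : ℕ)
    (hire : (ℕ → ℝ) → ℕ → ℤ) : ℝ :=
  offlineValue μ B T - policyValue μ T hire

/-- The certainty-equivalent quantile threshold with remaining budget `b` after `t` of the `T`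
candidates have been seen. -/
def ceQuantile (T : ℕ) (b : ℤ) (t : ℕ) : ℝ := 1 - (b : ℝ) / ((T : ℝ) - (t : ℝ))

open Classical in
/-- The certainty-equivalent decision on a candidate of ability `x` after `t` candidates have been
seen with remaining budget `b`: hire exactly if `F x` is at least the quantile threshold. -/
def ceDecision (F : ℝ → ℝ) (T : ℕ) (b : ℤ) (t : ℕ) (x : ℝ) : ℤ :=
  if ceQuantile T b t ≤ F x then 1 else 0

/-- The budget remaining under the certainty-equivalent policy after `t` candidates. It is an
integer because the rule itself does not forbid hiring with budget `0`, which requires `F x ≥ 1`;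
this has probability zero when the distribution has no atoms. -/
def ceBudget (F : ℝ → ℝ) (B T : ℕ) (θ : ℕ → ℝ) : ℕ → ℤ
  | 0 => (B : ℤ)
  | t + 1 => ceBudget F B T θ t - ceDecision F T (ceBudget F B T θ t) t (θ t)

/-- The hiring decisions of the certainty-equivalent policy with initial budget `B`, horizon `T`
and distribution function `F`. -/
def cePolicy (F : ℝ → ℝ) (B T : ℕ) (θ : ℕ → ℝ) (t : ℕ) : ℤ :=
  ceDecision F T (ceBudget F B T θ t) t (θ t)

end

end MultiSecretary

/-! Put q = 1 - F(c), the rate at which abilities above the gap arrive, and take B = ⌈Tq⌉, so that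
the CE threshold starts at the gap. If A candidates below the gap are hired and R above it are
rejected, swapping min(A, R) pairs in hindsight gains η per pair
(`cePolicy_add_gap_le_offlineReward`). So it suffices that E min(A, R) has order √T.

Both errors are driven by the surplus Z_t = B_t - (T - t)q. Given the past, CE hires a low candidate
with probability Z_t⁺/(T - t) and rejects a high one with probability Z_t⁻/(T - t)
(`integral_lowHire`, `integral_highReject`, `cdf_sub_ceQuantile`). Apart from the feedback of these
errors and rounding, -Z is the centred walk of high arrivals (`surplus_eq`). A stretch of length
proportional to T on which this walk averages order √T with a fixed sign therefore forces order √T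
errors of one kind. The feedback costs only a factor 2 (`min_counts_ge`), and since Z is
mean-reverting, the counts stay within order T^{1/4} of their compensators
(`integral_sq_compensated_le`).

It remains that, with probability bounded below, the walk is negative on average over a first
stretch, which causes low hires, and positive over a later one, which causes high rejections
(`exists_walk_sign_change`). This uses second and fourth moments instead of a limit theorem, so the
constants depend on F only through ε. -/

namespace MultiSecretary

/-! ### Bounded measurable functions and dependence on the past. -/

/-- Bounded measurable real functions. -/
def BddMeas {α : Type*} [MeasurableSpace α] (f : α → ℝ) : Prop :=
  Measurable f ∧ ∃ C : ℝ, ∀ x, |f x| ≤ C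

namespace BddMeas

variable {α β : Type*} [MeasurableSpace α] [MeasurableSpace β] {f g : α → ℝ}

lemma const (c : ℝ) : BddMeas (fun _ : α => c) := ⟨measurable_const, |c|, fun _ => le_rfl⟩

lemma add (hf : BddMeas f) (hg : BddMeas g) : BddMeas (fun x => f x + g x) := by
  obtain ⟨mf, C, hC⟩ := hf
  obtain ⟨mg, D, hD⟩ := hg
  exact ⟨mf.add mg, C + D, fun x => (abs_add_le _ _).trans (add_le_add (hC x) (hD x))⟩

lemma mul (hf : BddMeas f) (hg : BddMeas g) : BddMeas (fun x => f x * g x) := by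
  obtain ⟨mf, C, hC⟩ := hf
  obtain ⟨mg, D, hD⟩ := hg
  refine ⟨mf.mul mg, C * D, fun x => ?_⟩
  rw [abs_mul]
  exact mul_le_mul (hC x) (hD x) (abs_nonneg _) ((abs_nonneg _).trans (hC x))

lemma const_mul (c : ℝ) (hf : BddMeas f) : BddMeas (fun x => c * f x) := (const c).mul hf

lemma sub (hf : BddMeas f) (hg : BddMeas g) : BddMeas (fun x => f x - g x) := by
  simpa [sub_eq_add_neg] using hf.add (hg.const_mul (-1))

lemma pow (hf : BddMeas f) (n : ℕ) : BddMeas (fun x => f x ^ n) := by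
  induction n with
  | zero => simpa using const 1
  | succ n ih => simpa [pow_succ] using ih.mul hf

lemma sum {ι : Type*} (s : Finset ι) {F : ι → α → ℝ} (h : ∀ i ∈ s, BddMeas (F i)) :
    BddMeas (fun x => ∑ i ∈ s, F i x) := by
  classical
  induction s using Finset.induction_on with
  | empty => simpa using const 0
  | insert a s ha ih =>
    simp only [Finset.sum_insert ha]
    exact (h a (by simp)).add (ih fun i hi => h i (by simp [hi]))

lemma comp (hf : BddMeas f) {φ : β → α} (hφ : Measurable φ) : BddMeas (fun x => f (φ x)) :=
  ⟨hf.1.comp hφ, hf.2.imp fun _ h _ => h _⟩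

lemma abs (hf : BddMeas f) : BddMeas (fun x => |f x|) :=
  ⟨hf.1.abs, hf.2.imp fun _ h x => (abs_abs (f x)).trans_le (h x)⟩

lemma min (hf : BddMeas f) (hg : BddMeas g) : BddMeas (fun x => min (f x) (g x)) := by
  obtain ⟨mf, C, hC⟩ := hf
  obtain ⟨mg, D, hD⟩ := hg
  refine ⟨mf.min mg, max C D, fun x => ?_⟩
  exact abs_min_le_max_abs_abs.trans (max_le_max (hC x) (hD x))

lemma max (hf : BddMeas f) (hg : BddMeas g) : BddMeas (fun x => max (f x) (g x)) := by
  obtain ⟨mf, C, hC⟩ := hf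
  obtain ⟨mg, D, hD⟩ := hg
  refine ⟨mf.max mg, Max.max C D, fun x => ?_⟩
  exact abs_max_le_max_abs_abs.trans (max_le_max (hC x) (hD x))

lemma indicator {s : Set α} (hs : MeasurableSet s) (hf : BddMeas f) : BddMeas (s.indicator f) := by
  obtain ⟨mf, C, hC⟩ := hf
  refine ⟨mf.indicator hs, C, fun x => ?_⟩
  by_cases hx : x ∈ s
  · simpa [hx] using hC x
  · simpa [hx] using (abs_nonneg _).trans (hC x)

lemma integrable (hf : BddMeas f) (ν : Measure α) [IsFiniteMeasure ν] : Integrable f ν := by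
  obtain ⟨mf, C, hC⟩ := hf
  exact Integrable.of_bound mf.aestronglyMeasurable C (ae_of_all _ hC)

lemma integral_add (hf : BddMeas f) (hg : BddMeas g) (ν : Measure α) [IsFiniteMeasure ν] :
    ∫ x, (f x + g x) ∂ν = ∫ x, f x ∂ν + ∫ x, g x ∂ν :=
  MeasureTheory.integral_add (hf.integrable ν) (hg.integrable ν)

end BddMeas

/-- The value at `θ` is determined by the first `t` coordinates of `θ`. -/
def DependsOnPast {α : Type*} (t : ℕ) (f : (ℕ → ℝ) → α) : Prop :=
  ∀ θ θ' : ℕ → ℝ, (∀ s < t, θ s = θ' s) → f θ = f θ'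

lemma DependsOnPast.mono {α : Type*} {s t : ℕ} {f : (ℕ → ℝ) → α} (hf : DependsOnPast s f)
    (h : s ≤ t) : DependsOnPast t f :=
  fun _ _ hθ => hf _ _ fun r hr => hθ r (hr.trans_le h)

/-! ### Conditioning on the past; moments of martingales and weighted walks. -/

section

variable (μ : Measure ℝ) [IsProbabilityMeasure μ]

instance : IsProbabilityMeasure (abilityLaw μ) := by
  unfold abilityLaw; infer_instance

lemma measurePreserving_eval_abilityLaw (t : ℕ) :
    MeasurePreserving (fun θ : ℕ → ℝ => θ t) (abilityLaw μ) μ :=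
  measurePreserving_eval_infinitePi (fun _ : ℕ => μ) t

/-- The ability of candidate `t` may be integrated out given the first `t` candidates. -/
lemma integral_eval_of_dependsOnPast (t : ℕ) {f : (ℕ → ℝ) → ℝ → ℝ}
    (hf : BddMeas (Function.uncurry f)) (hp : DependsOnPast t f) :
    ∫ θ, f θ (θ t) ∂(abilityLaw μ) = ∫ θ, (∫ x, f θ x ∂μ) ∂(abilityLaw μ) := by
  classical
  have hind : iIndepFun (fun (i : ℕ) (θ : ℕ → ℝ) => θ i) (abilityLaw μ) :=
    iIndepFun_infinitePi (P := fun _ : ℕ => μ) (X := fun _ x => x) (fun _ => measurable_id)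
  have h1 := hind.indepFun_finset (Finset.range t) {t} (by simp) (fun i => measurable_pi_apply i)
  have h2 : IndepFun (fun (θ : ℕ → ℝ) (i : Finset.range t) => θ i) (fun θ => θ t)
      (abilityLaw μ) :=
    h1.comp (φ := fun y : Finset.range t → ℝ => y)
      (ψ := fun y : ({t} : Finset ℕ) → ℝ => y ⟨t, Finset.mem_singleton_self t⟩)
      measurable_id (measurable_pi_apply _)
  have mr : Measurable (fun (θ : ℕ → ℝ) (i : Finset.range t) => θ i) :=
    measurable_pi_lambda _ fun i => measurable_pi_apply _
  have me : Measurable (fun θ : ℕ → ℝ => θ t) := measurable_pi_apply _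
  have h3 := h2.map_prod_eq_prod_map_map mr.aemeasurable me.aemeasurable
  rw [(measurePreserving_eval_abilityLaw μ t).map_eq] at h3
  -- Padding by zeros makes `f` a function of the first `t` coordinates alone, so that Fubini
  -- applies to their joint law with coordinate `t`.
  let e : (Finset.range t → ℝ) → (ℕ → ℝ) := fun y i =>
    if h : i ∈ Finset.range t then y ⟨i, h⟩ else 0
  have he : Measurable e := by
    refine measurable_pi_lambda _ fun i => ?_
    by_cases h : i ∈ Finset.range t
    · simpa only [e, h, dif_pos] using measurable_pi_apply _
    · simpa only [e, h, dif_neg, not_false_eq_true] using measurable_const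
  have hfe : ∀ θ, f θ = f (e fun i => θ i) := fun θ => hp _ _ fun s hs => by simp [e, hs]
  have hG : BddMeas (fun p : (Finset.range t → ℝ) × ℝ => f (e p.1) p.2) :=
    hf.comp (φ := fun p : (Finset.range t → ℝ) × ℝ => (e p.1, p.2))
      ((he.comp measurable_fst).prodMk measurable_snd)
  have : IsProbabilityMeasure
      ((abilityLaw μ).map (fun (θ : ℕ → ℝ) (i : Finset.range t) => θ i)) :=
    Measure.isProbabilityMeasure_map mr.aemeasurable
  calc ∫ θ, f θ (θ t) ∂(abilityLaw μ)
      = ∫ θ, (fun p : (Finset.range t → ℝ) × ℝ => f (e p.1) p.2)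
          ((fun i => θ i), θ t) ∂(abilityLaw μ) := by
        refine integral_congr_ae (ae_of_all _ fun θ => ?_)
        exact congrFun (hfe θ) _
    _ = ∫ p, f (e p.1) p.2 ∂((abilityLaw μ).map (fun (θ : ℕ → ℝ) (i : Finset.range t) => θ i)).prod
          μ := by
        rw [← h3, integral_map (mr.prodMk me).aemeasurable hG.1.aestronglyMeasurable]
    _ = ∫ y, (∫ x, f (e y) x ∂μ)
          ∂((abilityLaw μ).map (fun (θ : ℕ → ℝ) (i : Finset.range t) => θ i)) :=
        integral_prod _ (hG.integrable _)
    _ = ∫ θ, (∫ x, f (e fun i => θ i) x ∂μ) ∂(abilityLaw μ) := by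
        rw [integral_map mr.aemeasurable]
        exact (hG.1.stronglyMeasurable.integral_prod_right').aestronglyMeasurable
    _ = _ := by
        refine integral_congr_ae (ae_of_all _ fun θ => ?_)
        exact congrArg (fun h : ℝ → ℝ => ∫ x, h x ∂μ) (hfe θ).symm

/-- Second moment of a sum of martingale differences. -/
lemma integral_sq_sum_martingaleDiff {D : ℕ → (ℕ → ℝ) → ℝ → ℝ} (n : ℕ)
    (hb : ∀ t < n, BddMeas (Function.uncurry (D t))) (hp : ∀ t < n, DependsOnPast t (D t))
    (h0 : ∀ t < n, ∀ᵐ θ ∂(abilityLaw μ), ∫ x, D t θ x ∂μ = 0) :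
    ∫ θ, (∑ t ∈ Finset.range n, D t θ (θ t)) ^ 2 ∂(abilityLaw μ)
      = ∑ t ∈ Finset.range n, ∫ θ, (∫ x, D t θ x ^ 2 ∂μ) ∂(abilityLaw μ) := by
  induction n with
  | zero => simp
  | succ n ih =>
    rw [Finset.sum_range_succ, ← ih (fun t ht => hb t (by omega)) (fun t ht => hp t (by omega))
      (fun t ht => h0 t (by omega))]
    set S : (ℕ → ℝ) → ℝ := fun θ => ∑ t ∈ Finset.range n, D t θ (θ t) with hS
    have bS : BddMeas S := BddMeas.sum _ fun t ht =>
      (hb t ((Finset.mem_range.1 ht).trans n.lt_succ_self)).comp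
        (φ := fun θ : ℕ → ℝ => (θ, θ t)) (by fun_prop)
    have pS : DependsOnPast n S := fun θ θ' h => Finset.sum_congr rfl fun t ht => by
      have ht := Finset.mem_range.1 ht
      rw [h t ht, hp t (by omega) θ θ' fun s hs => h s (by omega)]
    have bD := hb n (by omega)
    have bSu : BddMeas (Function.uncurry fun (θ : ℕ → ℝ) (_ : ℝ) => S θ) := bS.comp measurable_fst
    have key := integral_eval_of_dependsOnPast μ n (f := fun θ x => (S θ + D n θ x) ^ 2)
      ((bSu.add bD).pow 2) (fun θ θ' h => by
        funext x; simp only [pS θ θ' h, hp n (by omega) θ θ' h])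
    have bsec : ∀ θ, BddMeas (D n θ) := fun θ =>
      bD.comp (φ := fun x => (θ, x)) (by fun_prop)
    have hin : ∀ᵐ θ ∂(abilityLaw μ), ∫ x, (S θ + D n θ x) ^ 2 ∂μ
        = S θ ^ 2 + ∫ x, D n θ x ^ 2 ∂μ := by
      filter_upwards [h0 n (by omega)] with θ hθ
      have e1 : ∀ x, (S θ + D n θ x) ^ 2 = (S θ ^ 2 + 2 * S θ * D n θ x) + D n θ x ^ 2 :=
        fun x => by ring
      simp only [e1]
      rw [integral_add (((BddMeas.const _).add ((bsec θ).const_mul _)).integrable _)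
        (((bsec θ).pow 2).integrable _), integral_add ((BddMeas.const _).integrable _)
        (((bsec θ).const_mul _).integrable _), integral_const_mul, hθ]
      simp
    simp only [Finset.sum_range_succ]
    rw [key, integral_congr_ae hin, integral_add ((bS.pow 2).integrable _)]
    obtain ⟨m, C, hC⟩ := bD.pow 2
    refine Integrable.of_bound
      ((m.stronglyMeasurable.integral_prod_right').aestronglyMeasurable) C (ae_of_all _ fun θ => ?_)
    refine (norm_integral_le_of_norm_le_const (C := C) (ae_of_all _ fun x => hC (θ, x))).trans ?_
    simp

/-- A weighted sum of the increments `ξ (θ n), …, ξ (θ (n + m - 1))`. -/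
noncomputable def weightedWalk (ξ : ℝ → ℝ) (a : ℕ → ℝ) (n m : ℕ) (θ : ℕ → ℝ) : ℝ :=
  ∑ j ∈ Finset.range m, a j * ξ (θ (n + j))

lemma weightedWalk_succ (ξ : ℝ → ℝ) (a : ℕ → ℝ) (n m : ℕ) (θ : ℕ → ℝ) :
    weightedWalk ξ a n (m + 1) θ = weightedWalk ξ a n m θ + a m * ξ (θ (n + m)) :=
  Finset.sum_range_succ _ _

lemma BddMeas.weightedWalk {ξ : ℝ → ℝ} (hξ : BddMeas ξ) (a : ℕ → ℝ) (n m : ℕ) :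
    BddMeas (weightedWalk ξ a n m) :=
  BddMeas.sum _ fun j _ => (hξ.comp (φ := fun θ : ℕ → ℝ => θ (n + j)) (by fun_prop)).const_mul _

lemma dependsOnPast_weightedWalk (ξ : ℝ → ℝ) (a : ℕ → ℝ) (n m : ℕ) :
    DependsOnPast (n + m) (weightedWalk ξ a n m) := fun θ θ' h =>
  Finset.sum_congr rfl fun j hj => by
    rw [h (n + j) (by have := Finset.mem_range.1 hj; omega)]

/-- First, second and fourth moments of a weighted walk against a nonnegative weight depending only
on earlier coordinates. -/
lemma weightedWalk_moments {ξ : ℝ → ℝ} (hξ : Measurable ξ) (hξ1 : ∀ x, |ξ x| ≤ 1)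
    (h0 : ∫ x, ξ x ∂μ = 0) {g : (ℕ → ℝ) → ℝ} {n : ℕ} (hg : BddMeas g)
    (hgp : DependsOnPast n g) (hg0 : ∀ θ, 0 ≤ g θ) (a : ℕ → ℝ) (m : ℕ) :
    ∫ θ, g θ * weightedWalk ξ a n m θ ∂(abilityLaw μ) = 0 ∧
    ∫ θ, g θ * weightedWalk ξ a n m θ ^ 2 ∂(abilityLaw μ)
      = (∫ x, ξ x ^ 2 ∂μ) * (∑ j ∈ Finset.range m, a j ^ 2) * ∫ θ, g θ ∂(abilityLaw μ) ∧
    ∫ θ, g θ * weightedWalk ξ a n m θ ^ 4 ∂(abilityLaw μ)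
      ≤ 3 * (∑ j ∈ Finset.range m, a j ^ 2) ^ 2 * ∫ θ, g θ ∂(abilityLaw μ) := by
  have bξ : BddMeas ξ := ⟨hξ, 1, hξ1⟩
  set v := ∫ x, ξ x ^ 2 ∂μ with hv
  have hv0 : 0 ≤ v := integral_nonneg fun x => sq_nonneg _
  have hle : ∀ k : ℕ, ∫ x, ξ x ^ (2 * k) ∂μ ≤ 1 := fun k => by
    have := integral_mono ((bξ.pow (2 * k)).integrable μ) ((BddMeas.const 1).integrable μ)
      (fun x => by
        have := pow_le_one₀ (n := 2 * k) (abs_nonneg (ξ x)) (hξ1 x)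
        rwa [pow_mul, sq_abs, ← pow_mul] at this)
    simpa using this
  have hv1 : v ≤ 1 := hle 1
  have h41 : ∫ x, ξ x ^ 4 ∂μ ≤ 1 := hle 2
  have hG : 0 ≤ ∫ θ, g θ ∂(abilityLaw μ) := integral_nonneg hg0
  induction m with
  | zero => simp [weightedWalk]
  | succ m ih =>
    obtain ⟨ih1, ih2, ih4⟩ := ih
    set W := weightedWalk ξ a n m with hW
    have bW : BddMeas W := bξ.weightedWalk a n m
    have pW : DependsOnPast (n + m) W := dependsOnPast_weightedWalk ξ a n m
    have step : ∀ k : ℕ, ∫ θ, g θ * weightedWalk ξ a n (m + 1) θ ^ k ∂(abilityLaw μ)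
        = ∫ θ, (∫ x, g θ * (W θ + a m * ξ x) ^ k ∂μ) ∂(abilityLaw μ) := fun k => by
      have := integral_eval_of_dependsOnPast μ (n + m)
        (f := fun θ x => g θ * (W θ + a m * ξ x) ^ k)
        ((hg.comp measurable_fst).mul
          (((bW.comp measurable_fst).add ((bξ.comp measurable_snd).const_mul _)).pow k))
        (fun θ θ' h => by
          funext x
          simp only [pW θ θ' h, (hgp.mono (Nat.le_add_right n m)) θ θ' h])
      rw [← this]
      simp only [weightedWalk_succ, hW]
    have j1 : ∀ k, Integrable (fun θ => g θ * W θ ^ k) (abilityLaw μ) :=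
      fun k => (hg.mul (bW.pow k)).integrable _
    have jg : Integrable g (abilityLaw μ) := hg.integrable _
    rw [Finset.sum_range_succ]
    set V := ∑ j ∈ Finset.range m, a j ^ 2 with hV
    refine ⟨?_, ?_, ?_⟩
    · have s1 := step 1
      simp only [pow_one] at s1
      have e : ∀ θ, ∫ x, g θ * (W θ + a m * ξ x) ∂μ = g θ * W θ := fun θ => by
        rw [integral_const_mul, integral_add ((BddMeas.const _).integrable _)
          ((bξ.const_mul _).integrable _), integral_const_mul, h0]
        simp
      rw [s1]
      simp only [e]
      exact ih1
    · have e : ∀ θ, ∫ x, g θ * (W θ + a m * ξ x) ^ 2 ∂μ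
          = g θ * W θ ^ 2 + (a m ^ 2 * v) * g θ := fun θ => by
        have e1 : ∀ x, g θ * (W θ + a m * ξ x) ^ 2
            = g θ * W θ ^ 2 + (2 * g θ * W θ * a m) * ξ x + (g θ * a m ^ 2) * ξ x ^ 2 :=
          fun x => by ring
        simp only [e1]
        rw [integral_add (((BddMeas.const _).add (bξ.const_mul _)).integrable _)
          (((bξ.pow 2).const_mul _).integrable _), integral_add ((BddMeas.const _).integrable _)
          ((bξ.const_mul _).integrable _)]
        simp only [integral_const_mul, h0, integral_const, probReal_univ, smul_eq_mul, v]
        ring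
      rw [step 2]
      simp only [e]
      rw [integral_add (j1 2) (jg.const_mul _), ih2, integral_const_mul]
      ring
    · set m3 := ∫ x, ξ x ^ 3 ∂μ
      set m4 := ∫ x, ξ x ^ 4 ∂μ
      have e : ∀ θ, ∫ x, g θ * (W θ + a m * ξ x) ^ 4 ∂μ
          = g θ * W θ ^ 4 + (6 * a m ^ 2 * v) * (g θ * W θ ^ 2)
            + (4 * a m ^ 3 * m3) * (g θ * W θ) + (a m ^ 4 * m4) * g θ := fun θ => by
        have e1 : ∀ x, g θ * (W θ + a m * ξ x) ^ 4
            = g θ * W θ ^ 4 + (4 * g θ * W θ ^ 3 * a m) * ξ x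
              + (6 * g θ * W θ ^ 2 * a m ^ 2) * ξ x ^ 2
              + (4 * g θ * W θ * a m ^ 3) * ξ x ^ 3 + (g θ * a m ^ 4) * ξ x ^ 4 :=
          fun x => by ring
        simp only [e1]
        have b1 := (BddMeas.const (α := ℝ) (g θ * W θ ^ 4)).add
          (bξ.const_mul (4 * g θ * W θ ^ 3 * a m))
        have b2 := b1.add ((bξ.pow 2).const_mul (6 * g θ * W θ ^ 2 * a m ^ 2))
        have b3 := b2.add ((bξ.pow 3).const_mul (4 * g θ * W θ * a m ^ 3))
        rw [integral_add (b3.integrable _) (((bξ.pow 4).const_mul _).integrable _),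
          integral_add (b2.integrable _) (((bξ.pow 3).const_mul _).integrable _),
          integral_add (b1.integrable _) (((bξ.pow 2).const_mul _).integrable _),
          integral_add ((BddMeas.const _).integrable _) ((bξ.const_mul _).integrable _)]
        simp only [integral_const_mul, h0, ← hv]
        simp only [integral_const, probReal_univ, smul_eq_mul, m3, m4]
        ring
      rw [step 4]
      simp only [e]
      have b1 := hg.mul (bW.pow 4)
      have b2 := b1.add ((hg.mul (bW.pow 2)).const_mul (6 * a m ^ 2 * v))
      have b3 := b2.add ((hg.mul bW).const_mul (4 * a m ^ 3 * m3))
      rw [b3.integral_add (hg.const_mul _), b2.integral_add ((hg.mul bW).const_mul _),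
        b1.integral_add ((hg.mul (bW.pow 2)).const_mul _)]
      -- The first moment is carried through the induction for this step: it removes the term in
      -- `m3`. What remains is compared with 3(V + a²)² = 3V² + 6a²V + 3a⁴.
      simp only [integral_const_mul, ih1, ih2]
      set G := ∫ θ, g θ ∂(abilityLaw μ)
      have hV0 : 0 ≤ V := Finset.sum_nonneg fun j _ => sq_nonneg _
      have t1 : 6 * a m ^ 2 * v * (v * V * G) ≤ 6 * a m ^ 2 * V * G := by
        have : v * v ≤ 1 := by nlinarith
        have h := mul_le_mul_of_nonneg_right this
          (show 0 ≤ 6 * a m ^ 2 * V * G by positivity)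
        linarith
      have t2 : a m ^ 4 * m4 * G ≤ a m ^ 4 * G := by
        have h := mul_le_mul_of_nonneg_right h41 (show 0 ≤ a m ^ 4 * G by positivity)
        linarith
      have t3 : 0 ≤ a m ^ 4 * G := by positivity
      nlinarith

end

/-! ### Anticoncentration and sign change of the averaged walk. -/

/-- A centred variable with comparable second and fourth moments is large with a probability
bounded below (with respect to the weight `g`). -/
lemma weighted_anticoncentration {Ω : Type*} [MeasurableSpace Ω] (P : Measure Ω)
    [IsProbabilityMeasure P] {g Y : Ω → ℝ} (hg : BddMeas g) (hg0 : ∀ ω, 0 ≤ g ω) (hY : BddMeas Y)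
    {e r k : ℝ} (he : 0 < e) (hr : 0 < r) (hk : 0 < k) (hk2 : k ^ 2 = e / 3)
    (h1 : ∫ ω, g ω * Y ω ∂P = 0)
    (h2 : e * r ^ 2 * ∫ ω, g ω ∂P ≤ ∫ ω, g ω * Y ω ^ 2 ∂P)
    (h2' : ∫ ω, g ω * Y ω ^ 2 ∂P ≤ r ^ 2 * ∫ ω, g ω ∂P)
    (h4 : ∫ ω, g ω * Y ω ^ 4 ∂P ≤ 3 * (r ^ 2) ^ 2 * ∫ ω, g ω ∂P) :
    e ^ 3 / 24 * ∫ ω, g ω ∂P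
      ≤ ∫ ω, g ω * {ω | e * k * r / 8 ≤ Y ω}.indicator (fun _ => 1) ω ∂P := by
  set G := ∫ ω, g ω ∂P with hGd
  have hG : 0 ≤ G := integral_nonneg hg0
  -- The minorant below gives at least (l · ekr - l²r² - 2ld)G. This `l` maximizes the first two
  -- terms, to e²k²/4, and `d` spends half of that, which leaves e²k²/8 = e³/24.
  set l := e * k / (2 * r) with hl
  set d := e * k * r / 8 with hd
  have hl0 : 0 < l := by positivity
  have hd0 : 0 < d := by positivity
  have hYm : MeasurableSet {ω | d ≤ Y ω} := measurableSet_le measurable_const hY.1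
  -- pointwise quartic minorant of the indicator
  have pt : ∀ w : ℝ, l * w + (l * (3 / 2 * (k / r)) - l ^ 2) * w ^ 2
      + (-(l * ((k / r) ^ 3 / 2))) * w ^ 4 + (-(2 * l * d)) ≤ if d ≤ w then 1 else 0 := fun w => by
    set q := k / r with hq
    have hq0 : 0 < q := by positivity
    -- An even quartic touching |w| at |w| = 1/q. With the moment bounds it gives ∫ g|Y| ≥ (3/2)(ek
    -- - k³)rG, and k² = e/3 maximizes the right side, to ekrG.
    have habs : 3 / 2 * q * w ^ 2 - q ^ 3 / 2 * w ^ 4 ≤ |w| := by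
      have hw := abs_nonneg w
      have e2 : w ^ 2 = |w| ^ 2 := (sq_abs w).symm
      have e4 : w ^ 4 = |w| ^ 4 := by
        rw [show w ^ 4 = (w ^ 2) ^ 2 by ring, e2]; ring
      rw [e2, e4]
      set u := |w|
      have : 0 ≤ u * (q * u - 1) ^ 2 * (q * u + 2) := by positivity
      nlinarith
    have hlw := mul_le_mul_of_nonneg_left habs hl0.le
    split_ifs with h
    · have hw : 0 ≤ w := hd0.le.trans h
      rw [abs_of_nonneg hw] at hlw
      nlinarith [sq_nonneg (l * w - 1), mul_pos hl0 hd0]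
    · push Not at h
      rcases le_total 0 w with hw | hw
      · rw [abs_of_nonneg hw] at hlw
        nlinarith [sq_nonneg (l * w), mul_lt_mul_of_pos_left h hl0]
      · rw [abs_of_nonpos hw] at hlw
        nlinarith [sq_nonneg (l * w), mul_pos hl0 hd0]
  set A := l * (3 / 2 * (k / r)) - l ^ 2 with hA
  set B := l * ((k / r) ^ 3 / 2) with hB
  have int : ∀ j, Integrable (fun ω => g ω * Y ω ^ j) P := fun j => (hg.mul (hY.pow j)).integrable _
  have int1 : Integrable (fun ω => g ω * Y ω) P := (hg.mul hY).integrable _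
  have intg : Integrable g P := hg.integrable _
  have low : ∫ ω, (l * (g ω * Y ω) + A * (g ω * Y ω ^ 2) + (-B) * (g ω * Y ω ^ 4)
      + (-(2 * l * d)) * g ω) ∂P
      ≤ ∫ ω, g ω * {ω | d ≤ Y ω}.indicator (fun _ => 1) ω ∂P := by
    refine integral_mono ((((int1.const_mul _).add ((int 2).const_mul _)).add
      ((int 4).const_mul _)).add (intg.const_mul _))
      ((hg.mul ((BddMeas.const 1).indicator hYm)).integrable _) fun ω => ?_
    have h := mul_le_mul_of_nonneg_left (pt (Y ω)) (hg0 ω)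
    simp only [Set.indicator_apply, Set.mem_ofPred_eq]
    refine le_trans (le_of_eq ?_) h
    ring
  refine le_trans ?_ low
  have b1 := (hg.mul hY).const_mul l
  have b2 := b1.add ((hg.mul (hY.pow 2)).const_mul A)
  have b3 := b2.add ((hg.mul (hY.pow 4)).const_mul (-B))
  rw [b3.integral_add (hg.const_mul _), b2.integral_add ((hg.mul (hY.pow 4)).const_mul _),
    b1.integral_add ((hg.mul (hY.pow 2)).const_mul _)]
  simp only [integral_const_mul, h1, ← hGd]
  set M2 := ∫ ω, g ω * Y ω ^ 2 ∂P
  set M4 := ∫ ω, g ω * Y ω ^ 4 ∂P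
  have hB0 : 0 ≤ B := by positivity
  have s1 : l * (3 / 2 * (k / r)) * (e * r ^ 2 * G) ≤ l * (3 / 2 * (k / r)) * M2 :=
    mul_le_mul_of_nonneg_left h2 (by positivity)
  have s2 : l ^ 2 * M2 ≤ l ^ 2 * (r ^ 2 * G) := mul_le_mul_of_nonneg_left h2' (by positivity)
  have s4 : B * M4 ≤ B * (3 * (r ^ 2) ^ 2 * G) := mul_le_mul_of_nonneg_left h4 hB0
  have c1 : l * (3 / 2 * (k / r)) * (e * r ^ 2 * G) = 3 / 4 * e ^ 2 * k ^ 2 * G := by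
    rw [hl]; field_simp; ring
  have c2 : l ^ 2 * (r ^ 2 * G) = e ^ 2 * k ^ 2 / 4 * G := by
    rw [hl]; field_simp; ring
  have c4 : B * (3 * (r ^ 2) ^ 2 * G) = 3 / 4 * e * (k ^ 2) ^ 2 * G := by
    rw [hB, hl]; field_simp; ring
  have c0 : 2 * l * d * G = e ^ 2 * k ^ 2 / 8 * G := by
    rw [hl, hd]; field_simp
  rw [hk2] at c1 c2 c4 c0
  rw [hA]
  nlinarith

/-- Increment `j` enters every partial sum of length above `j`. The area under the walk thus becomes
a linear form in independent increments. -/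
lemma sum_partialSums (x : ℕ → ℝ) (m : ℕ) :
    ∑ t ∈ Finset.range m, ∑ s ∈ Finset.range t, x s
      = ∑ j ∈ Finset.range m, ((m : ℝ) - 1 - j) * x j := by
  induction m with
  | zero => simp
  | succ m ih =>
    rw [Finset.sum_range_succ, ih, Finset.sum_range_succ, ← Finset.sum_add_distrib]
    push_cast
    rw [show ((m : ℝ) + 1 - 1 - m) * x m = 0 by ring, add_zero]
    exact Finset.sum_congr rfl fun j _ => by ring

/-- Makes the area under a walk of length m fluctuate on the scale m^{3/2}. The sum vanishes at m =
1. -/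
lemma cube_le_sum_sq_weights {m : ℕ} (hm : 2 ≤ m) :
    (m : ℝ) ^ 3 / 16 ≤ ∑ j ∈ Finset.range m, ((m : ℝ) - 1 - j) ^ 2 := by
  have h : ∀ m : ℕ, ∑ j ∈ Finset.range m, ((m : ℝ) - 1 - j) ^ 2
      = ((m : ℝ) - 1) * m * (2 * m - 1) / 6 := fun m => by
    induction m with
    | zero => simp
    | succ m ih =>
      rw [Finset.sum_range_succ']
      have : ∀ j : ℕ, (((m + 1 : ℕ) : ℝ) - 1 - ((j + 1 : ℕ) : ℝ)) ^ 2 = ((m : ℝ) - 1 - j) ^ 2 :=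
        fun j => by push_cast; ring
      simp only [this, ih]
      push_cast
      ring
  rw [h]
  have : (2 : ℝ) ≤ m := by exact_mod_cast hm
  nlinarith [mul_nonneg (sub_nonneg.2 this) (sub_nonneg.2 this)]

/-- Chebyshev's inequality. -/
lemma integral_indicator_abs_gt_le {Ω : Type*} [MeasurableSpace Ω] (P : Measure Ω)
    [IsProbabilityMeasure P] {S : Ω → ℝ} (hS : BddMeas S) {a : ℝ} (ha : 0 < a) :
    ∫ ω, {ω | a < |S ω|}.indicator (fun _ => (1 : ℝ)) ω ∂P ≤ (∫ ω, S ω ^ 2 ∂P) / a ^ 2 := by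
  rw [← integral_div]
  refine integral_mono (((BddMeas.const 1).indicator
    (measurableSet_lt measurable_const hS.1.abs)).integrable P)
    (((hS.pow 2).integrable P).div_const _) fun ω => ?_
  simp only [Set.indicator_apply, Set.mem_ofPred_eq]
  split_ifs with h
  · rw [le_div_iff₀ (by positivity), one_mul, ← sq_abs (S ω)]
    exact pow_le_pow_left₀ ha.le h.le 2
  · positivity

/-- A centred bounded random walk has, with probability bounded below, a first stretch that is
substantially negative on average and a second stretch that is substantially positive. -/
lemma exists_walk_sign_change (e : ℝ) (he : 0 < e) :
    ∃ κ : ℕ, 1 ≤ κ ∧ ∃ c : ℝ, 0 < c ∧ ∀ (μ : Measure ℝ) [IsProbabilityMeasure μ] (ξ : ℝ → ℝ),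
      Measurable ξ → (∀ x, |ξ x| ≤ 1) → ∫ x, ξ x ∂μ = 0 → e ≤ ∫ x, ξ x ^ 2 ∂μ →
      ∀ n : ℕ, 2 ≤ n → c * (n * √n) ≤ ∫ θ,
        min (max (-∑ t ∈ Finset.range n, ∑ s ∈ Finset.range t, ξ (θ s)) 0)
          (max (∑ t ∈ Finset.range (κ * n), ∑ s ∈ Finset.range (n + t), ξ (θ s)) 0)
        ∂(abilityLaw μ) := by
  set k := √(e / 3) with hk
  have hk0 : 0 < k := by positivity
  have hk2 : k ^ 2 = e / 3 := Real.sq_sqrt (by positivity)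
  set d := e * k / 8 with hd
  have hd0 : 0 < d := by positivity
  set p := e ^ 3 / 24 with hp
  have hp0 : 0 < p := by positivity
  -- By Chebyshev the walk at time `n` exceeds K√n in absolute value with probability at most 1/K² =
  -- p/2, half of what the first stretch provides.
  set K := √(2 / p) with hK
  have hK0 : 0 < K := by positivity
  have hK2 : K ^ 2 = 2 / p := Real.sq_sqrt (by positivity)
  -- The second stretch must be long enough that its own fluctuation (d/4)m√m is at least 2Km√n,
  -- twice the effect Km√n of its starting height.
  obtain ⟨κ, hκ⟩ := exists_nat_ge (max 1 ((8 * K / d) ^ 2))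
  have hκ1 : 1 ≤ κ := by exact_mod_cast (le_max_left _ _).trans hκ
  have hκs : 8 * K / d ≤ √κ := Real.le_sqrt_of_sq_le ((le_max_right _ _).trans hκ)
  refine ⟨κ, hκ1, p * (p / 2) * min (d / 4) K, by positivity, ?_⟩
  intro μ _ ξ mξ hξ1 hξ0 hξ2 n hn
  have bξ : BddMeas ξ := ⟨mξ, 1, hξ1⟩
  have hv1 : ∫ x, ξ x ^ 2 ∂μ ≤ 1 := by
    have := integral_mono ((bξ.pow 2).integrable μ) ((BddMeas.const 1).integrable μ)
      (fun x => by
        have := pow_le_one₀ (n := 2) (abs_nonneg (ξ x)) (hξ1 x)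
        rwa [sq_abs] at this)
    simpa using this
  have hn0 : (0 : ℝ) < n := by exact_mod_cast (show 0 < n by omega)
  -- anticoncentration of a linear form in the increments from `n` on
  have anti : ∀ (g : (ℕ → ℝ) → ℝ) (n m : ℕ) (a : ℕ → ℝ), BddMeas g → DependsOnPast n g →
      (∀ θ, 0 ≤ g θ) → 2 ≤ m → (∀ j, a j ^ 2 = ((m : ℝ) - 1 - j) ^ 2) →
      p * ∫ θ, g θ ∂(abilityLaw μ) ≤ ∫ θ, g θ *
        {θ | d / 4 * (m * √m) ≤ weightedWalk ξ a n m θ}.indicator (fun _ => 1) θ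
          ∂(abilityLaw μ) := by
    intro g n m a hg hgp hg0 hm ha
    obtain ⟨h1, h2, h4⟩ := weightedWalk_moments μ mξ hξ1 hξ0 hg hgp hg0 a m
    set V := ∑ j ∈ Finset.range m, a j ^ 2 with hV
    have hVm : (m : ℝ) ^ 3 / 16 ≤ V := by
      rw [hV]; simp only [ha]; exact cube_le_sum_sq_weights hm
    have hm0 : (0 : ℝ) < m := by exact_mod_cast (show 0 < m by omega)
    have hV0 : 0 < V := lt_of_lt_of_le (by positivity) hVm
    have hr2 : √V ^ 2 = V := Real.sq_sqrt hV0.le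
    have hr : m * √m / 4 ≤ √V := by
      apply Real.le_sqrt_of_sq_le
      rw [div_pow, mul_pow, Real.sq_sqrt hm0.le]
      refine le_trans (le_of_eq ?_) hVm
      ring
    have hG : 0 ≤ ∫ θ, g θ ∂(abilityLaw μ) := integral_nonneg hg0
    have bW := bξ.weightedWalk a n m
    have := weighted_anticoncentration (abilityLaw μ) hg hg0 bW (r := √V)
      he (Real.sqrt_pos.2 hV0) hk0 hk2 h1
      (by rw [h2, hr2]; gcongr) (by rw [h2, hr2]; nlinarith [mul_nonneg hV0.le hG])
      (by rw [hr2]; exact h4)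
    refine this.trans (integral_mono ((hg.mul ((BddMeas.const 1).indicator
      (measurableSet_le measurable_const bW.1))).integrable _) ((hg.mul ((BddMeas.const 1).indicator
      (measurableSet_le measurable_const bW.1))).integrable _) fun θ => ?_)
    refine mul_le_mul_of_nonneg_left ?_ (hg0 θ)
    refine Set.indicator_le_indicator_of_subset (fun θ hθ => ?_) (fun _ => zero_le_one) θ
    have hθ : e * k * √V / 8 ≤ weightedWalk ξ a n m θ := hθ
    change d / 4 * (m * √m) ≤ weightedWalk ξ a n m θ
    refine le_trans ?_ hθ
    have := mul_le_mul_of_nonneg_left hr hd0.le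
    rw [hd] at this ⊢
    linarith
  set W1 := weightedWalk ξ (fun j => -((n : ℝ) - 1 - j)) 0 n with hW1
  set S := weightedWalk ξ (fun _ => 1) 0 n with hS
  have bW1 : BddMeas W1 := bξ.weightedWalk _ _ _
  have bS : BddMeas S := bξ.weightedWalk _ _ _
  set E1 := {θ : ℕ → ℝ | d / 4 * (n * √n) ≤ W1 θ} with hE1
  set E2 := {θ : ℕ → ℝ | K * √n < |S θ|} with hE2
  have mE1 : MeasurableSet E1 := measurableSet_le measurable_const bW1.1
  have mE2 : MeasurableSet E2 := measurableSet_lt measurable_const bS.1.abs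
  have i1 : p ≤ ∫ θ, E1.indicator (fun _ => (1 : ℝ)) θ ∂(abilityLaw μ) := by
    have := anti (fun _ => 1) 0 n (fun j => -((n : ℝ) - 1 - j)) (BddMeas.const 1)
      (fun _ _ _ => rfl) (fun _ => zero_le_one) hn (fun j => by ring)
    simp only [one_mul, mul_one, integral_const, probReal_univ, smul_eq_mul] at this
    exact this
  have i2 : ∫ θ, E2.indicator (fun _ => (1 : ℝ)) θ ∂(abilityLaw μ) ≤ p / 2 := by
    refine (integral_indicator_abs_gt_le (abilityLaw μ) bS (by positivity)).trans ?_
    have := (weightedWalk_moments μ mξ hξ1 hξ0 (BddMeas.const 1) (n := 0)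
      (fun _ _ _ => rfl) (fun _ => zero_le_one) (fun _ => 1) n).2.1
    simp only [one_mul, one_pow, Finset.sum_const, Finset.card_range, nsmul_eq_mul, mul_one,
      integral_const, probReal_univ, smul_eq_mul] at this
    rw [← hS] at this
    rw [this, mul_pow, hK2, Real.sq_sqrt hn0.le, div_le_iff₀ (by positivity)]
    calc (∫ x, ξ x ^ 2 ∂μ) * n ≤ 1 * n := by gcongr
      _ = p / 2 * (2 / p * n) := by field_simp
  -- The first stretch has a very negative area but ends at a moderate height. As a weight in
  -- `anti`, `g` plays the role of conditioning on this event.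
  set g : (ℕ → ℝ) → ℝ := (E1 \ E2).indicator fun _ => 1 with hg
  have bg : BddMeas g := (BddMeas.const 1).indicator (mE1.diff mE2)
  have hg0 : ∀ θ, 0 ≤ g θ := fun θ => Set.indicator_nonneg (fun _ _ => zero_le_one) _
  have hgp : DependsOnPast n g := by
    intro θ θ' h
    have e1 : W1 θ = W1 θ' := dependsOnPast_weightedWalk ξ _ 0 n θ θ' (by simpa using h)
    have e2 : S θ = S θ' := dependsOnPast_weightedWalk ξ _ 0 n θ θ' (by simpa using h)
    simp only [hg, Set.indicator_apply, Set.mem_sdiff, hE1, hE2, Set.mem_ofPred_eq, e1, e2]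
  have ig : p / 2 ≤ ∫ θ, g θ ∂(abilityLaw μ) := by
    have b1 := (BddMeas.const (α := ℕ → ℝ) 1).indicator mE1
    have b2 := (BddMeas.const (α := ℕ → ℝ) 1).indicator mE2
    have : ∫ θ, (E1.indicator (fun _ => (1 : ℝ)) θ - E2.indicator (fun _ => (1 : ℝ)) θ)
        ∂(abilityLaw μ) ≤ ∫ θ, g θ ∂(abilityLaw μ) := by
      refine integral_mono ((b1.sub b2).integrable _) (bg.integrable _) fun θ => ?_
      simp only [hg, Set.indicator_apply, Set.mem_sdiff]
      by_cases h1 : θ ∈ E1 <;> by_cases h2 : θ ∈ E2 <;> simp [h1, h2]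
    rw [integral_sub (b1.integrable _) (b2.integrable _)] at this
    linarith
  set m := κ * n with hm
  have hm2 : 2 ≤ m := by nlinarith
  set W2 := weightedWalk ξ (fun j => (m : ℝ) - 1 - j) n m with hW2
  have bW2 : BddMeas W2 := bξ.weightedWalk _ _ _
  have i3 := anti g n m (fun j => (m : ℝ) - 1 - j) bg hgp hg0 hm2 (fun j => rfl)
  rw [← hW2] at i3
  set E3 := {θ : ℕ → ℝ | d / 4 * (m * √m) ≤ W2 θ} with hE3
  have mE3 : MeasurableSet E3 := measurableSet_le measurable_const bW2.1
  have bX : ∀ t, BddMeas fun θ : ℕ → ℝ => ∑ s ∈ Finset.range t, ξ (θ s) := fun t =>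
    BddMeas.sum _ fun s _ => bξ.comp (φ := fun θ : ℕ → ℝ => θ s) (by fun_prop)
  have bA : BddMeas fun θ : ℕ → ℝ => -∑ t ∈ Finset.range n, ∑ s ∈ Finset.range t, ξ (θ s) := by
    simpa using (BddMeas.sum (Finset.range n) fun t _ => bX t).const_mul (-1)
  have bB : BddMeas fun θ : ℕ → ℝ =>
      ∑ t ∈ Finset.range m, ∑ s ∈ Finset.range (n + t), ξ (θ s) :=
    BddMeas.sum (Finset.range m) fun t _ => bX (n + t)
  have hA : ∀ θ, -∑ t ∈ Finset.range n, ∑ s ∈ Finset.range t, ξ (θ s) = W1 θ := fun θ => by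
    rw [sum_partialSums (fun s => ξ (θ s)), hW1, weightedWalk, ← Finset.sum_neg_distrib]
    exact Finset.sum_congr rfl fun j _ => by rw [zero_add]; ring
  -- The second area splits into the starting height times the length and the area of a fresh walk.
  have hB : ∀ θ, ∑ t ∈ Finset.range m, ∑ s ∈ Finset.range (n + t), ξ (θ s) = m * S θ + W2 θ :=
    fun θ => by
    simp only [Finset.sum_range_add, Finset.sum_add_distrib]
    rw [sum_partialSums (fun s => ξ (θ (n + s))), hW2, hS, weightedWalk, weightedWalk]
    simp
  have fin : ∫ θ, (min (d / 4) K * (n * √n)) * (g θ * E3.indicator (fun _ => 1) θ)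
      ∂(abilityLaw μ) ≤ ∫ θ,
        min (max (-∑ t ∈ Finset.range n, ∑ s ∈ Finset.range t, ξ (θ s)) 0)
          (max (∑ t ∈ Finset.range m, ∑ s ∈ Finset.range (n + t), ξ (θ s)) 0)
        ∂(abilityLaw μ) := by
    refine integral_mono (((bg.mul ((BddMeas.const 1).indicator mE3)).const_mul _).integrable _)
      (((bA.max (BddMeas.const 0)).min (bB.max (BddMeas.const 0))).integrable _) fun θ => ?_
    have hnn : (0 : ℝ) ≤ n * √n := by positivity
    simp only [hA, hB]
    by_cases h : θ ∈ (E1 \ E2) ∩ E3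
    · obtain ⟨⟨h1, h2⟩, h3⟩ := h
      have h12 : θ ∈ E1 \ E2 := ⟨h1, h2⟩
      have hgθ : g θ = 1 := Set.indicator_of_mem h12 _
      have h1 : d / 4 * (n * √n) ≤ W1 θ := h1
      have h2 : |S θ| ≤ K * √n := not_lt.1 h2
      rw [Set.indicator_of_mem h3, hgθ, mul_one, mul_one]
      have h3 : d / 4 * (m * √m) ≤ W2 θ := h3
      refine le_min (le_max_of_le_left ?_) (le_max_of_le_left ?_)
      · exact (mul_le_mul_of_nonneg_right (min_le_left _ _) hnn).trans h1
      · refine (mul_le_mul_of_nonneg_right (min_le_right _ _) hnn).trans ?_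
        have hmR : (m : ℝ) = κ * n := by rw [hm]; push_cast; ring
        have hκR : (1 : ℝ) ≤ κ := by exact_mod_cast hκ1
        have hsm : √(m : ℝ) = √κ * √n := by rw [hmR, Real.sqrt_mul (by positivity)]
        have hnm : (n : ℝ) ≤ m := by rw [hmR]; nlinarith
        have hdk : 8 * K ≤ d * √κ := by rw [div_le_iff₀ hd0] at hκs; linarith
        have hms : (0 : ℝ) ≤ m * √n := by positivity
        have a1 : 2 * K * (m * √n) ≤ d / 4 * (m * √m) := by
          rw [hsm]; nlinarith [mul_le_mul_of_nonneg_right hdk hms]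
        have a2 : -(K * (m * √n)) ≤ m * S θ := by
          have := mul_le_mul_of_nonneg_left (abs_le.1 h2).1 (Nat.cast_nonneg (α := ℝ) m)
          linarith
        have a3 : K * (n * √n) ≤ K * (m * √n) := by gcongr
        linarith
    · have : g θ * E3.indicator (fun _ => 1) θ = 0 := by
        by_cases h' : θ ∈ E1 \ E2
        · have h3 : θ ∉ E3 := fun h3 => h (Set.mem_inter h' h3)
          rw [Set.indicator_of_notMem h3, mul_zero]
        · rw [hg, Set.indicator_of_notMem h', zero_mul]
      rw [this, mul_zero]
      exact le_min (le_max_right _ _) (le_max_right _ _)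
  refine le_trans ?_ fin
  rw [integral_const_mul]
  have hc : 0 ≤ min (d / 4) K * (n * √n) := by positivity
  calc p * (p / 2) * min (d / 4) K * (n * √n) = (min (d / 4) K * (n * √n)) * (p * (p / 2)) := by
        ring
    _ ≤ _ := by gcongr; exact (mul_le_mul_of_nonneg_left ig hp0.le).trans i3

/-! ### Distribution functions without atoms. -/

section Cdf

variable {μ : Measure ℝ} [IsProbabilityMeasure μ]

/-- A jump of the distribution function is the mass of an atom. -/
lemma continuous_cdf_of_noAtoms (h : ∀ x, μ {x} = 0) : Continuous (cdf μ) := by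
  rw [continuous_iff_continuousAt]
  intro x
  rw [(monotone_cdf μ).continuousAt_iff_leftLim_eq_rightLim, (cdf μ).rightLim_eq]
  have h1 := (cdf μ).measure_singleton x
  rw [measure_cdf, h x, eq_comm, ENNReal.ofReal_eq_zero] at h1
  exact le_antisymm ((monotone_cdf μ).leftLim_le le_rfl) (by linarith)

lemma measureReal_Ioi_eq (x : ℝ) : μ.real (Set.Ioi x) = 1 - cdf μ x := by
  rw [cdf_eq_real, ← probReal_compl_eq_one_sub measurableSet_Iic, Set.compl_Iic]

/-- The probability integral transform. -/
lemma measureReal_le_cdf (h : ∀ x, μ {x} = 0) {p : ℝ} (hp0 : 0 ≤ p) (hp1 : p ≤ 1) :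
    μ.real {x | p ≤ cdf μ x} = 1 - p := by
  have surj : ∀ p' : ℝ, 0 < p' → p' < 1 → ∃ x, cdf μ x = p' := fun p' h0 h1 =>
    mem_range_of_exists_le_of_exists_ge (continuous_cdf_of_noAtoms h)
      (((tendsto_cdf_atBot μ).eventually (gt_mem_nhds h0)).exists.imp fun _ => le_of_lt)
      (((tendsto_cdf_atTop μ).eventually (lt_mem_nhds h1)).exists.imp fun _ => le_of_lt)
  rcases hp0.eq_or_lt with rfl | hp0
  · simp [cdf_nonneg]
  apply le_antisymm
  · refine le_of_forall_gt_imp_ge_of_dense fun a ha => ?_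
    by_cases ha1 : 1 ≤ a
    · exact (measureReal_le_one).trans ha1
    push Not at ha1
    obtain ⟨x, hx⟩ := surj (1 - a) (by linarith) (by linarith)
    calc μ.real {x | p ≤ cdf μ x} ≤ μ.real (Set.Ioi x) := by
          refine measureReal_mono (fun y hy => ?_)
          have hy : p ≤ cdf μ y := hy
          by_contra hyx
          have := monotone_cdf μ (not_lt.1 hyx)
          linarith
      _ = a := by rw [measureReal_Ioi_eq, hx]; ring
  · rcases hp1.eq_or_lt with rfl | hp1
    · simp
    obtain ⟨x, hx⟩ := surj p hp0 hp1
    rw [← hx, ← measureReal_Ioi_eq]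
    exact measureReal_mono fun y hy => monotone_cdf μ (le_of_lt hy)

lemma ae_cdf_lt_one (h : ∀ x, μ {x} = 0) : ∀ᵐ x ∂μ, cdf μ x < 1 := by
  have := measureReal_le_cdf h zero_le_one le_rfl
  rw [sub_self, measureReal_eq_zero_iff] at this
  rw [ae_iff]
  simpa using this

lemma ae_notMem_gap {c d : ℝ} (h : cdf μ c = Function.leftLim (cdf μ) d) :
    ∀ᵐ x ∂μ, x ∉ Set.Ioo c d := by
  have := (cdf μ).measure_Ioo (a := c) (b := d)
  rw [measure_cdf, ← h, sub_self, ENNReal.ofReal_zero] at this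
  exact measure_eq_zero_iff_ae_notMem.1 this

end Cdf

/-! ### Pathwise dynamics of the CE budget. -/

section Dynamics

noncomputable section

/-- Indicator that an ability above `c` arrives. -/
def highArrival (c x : ℝ) : ℝ := if c < x then 1 else 0

/-- Indicator that the CE rule hires a candidate of ability `x ≤ c`. -/
def lowHire (F : ℝ → ℝ) (c : ℝ) (T : ℕ) (b : ℤ) (t : ℕ) (x : ℝ) : ℝ :=
  if x ≤ c ∧ ceQuantile T b t ≤ F x then 1 else 0

/-- Indicator that the CE rule rejects a candidate of ability `x > c`. -/
def highReject (F : ℝ → ℝ) (c : ℝ) (T : ℕ) (b : ℤ) (t : ℕ) (x : ℝ) : ℝ :=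
  if c < x ∧ F x < ceQuantile T b t then 1 else 0

/-- Budget in excess of what is needed to hire a fraction `q` of the remaining candidates. -/
def surplus (F : ℝ → ℝ) (q : ℝ) (B T : ℕ) (θ : ℕ → ℝ) (t : ℕ) : ℝ :=
  (ceBudget F B T θ t : ℝ) - ((T : ℝ) - t) * q

/-- Number of abilities at most `c` hired among the first `t` candidates. -/
def lowHireCount (F : ℝ → ℝ) (c : ℝ) (B T : ℕ) (θ : ℕ → ℝ) (t : ℕ) : ℝ :=
  ∑ s ∈ Finset.range t, lowHire F c T (ceBudget F B T θ s) s (θ s)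

/-- Number of abilities above `c` rejected among the first `t` candidates. -/
def highRejectCount (F : ℝ → ℝ) (c : ℝ) (B T : ℕ) (θ : ℕ → ℝ) (t : ℕ) : ℝ :=
  ∑ s ∈ Finset.range t, highReject F c T (ceBudget F B T θ s) s (θ s)

end

lemma lowHire_mem (F : ℝ → ℝ) (c : ℝ) (T : ℕ) (b : ℤ) (t : ℕ) (x : ℝ) :
    lowHire F c T b t x = 0 ∨ lowHire F c T b t x = 1 := by
  unfold lowHire; split_ifs <;> simp

lemma highReject_mem (F : ℝ → ℝ) (c : ℝ) (T : ℕ) (b : ℤ) (t : ℕ) (x : ℝ) :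
    highReject F c T b t x = 0 ∨ highReject F c T b t x = 1 := by
  unfold highReject; split_ifs <;> simp

lemma ceDecision_mem (F : ℝ → ℝ) (T : ℕ) (b : ℤ) (t : ℕ) (x : ℝ) :
    ceDecision F T b t x = 0 ∨ ceDecision F T b t x = 1 := by
  unfold ceDecision; split_ifs <;> simp

lemma lowHire_nonneg (F : ℝ → ℝ) (c : ℝ) (T : ℕ) (b : ℤ) (t : ℕ) (x : ℝ) :
    0 ≤ lowHire F c T b t x := by
  rcases lowHire_mem F c T b t x with h | h <;> simp [h]

lemma highReject_nonneg (F : ℝ → ℝ) (c : ℝ) (T : ℕ) (b : ℤ) (t : ℕ) (x : ℝ) :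
    0 ≤ highReject F c T b t x := by
  rcases highReject_mem F c T b t x with h | h <;> simp [h]

/-- CE is compared with the rule that hires exactly the candidates above `c`; the last two terms are
its deviations. -/
lemma ceDecision_eq (F : ℝ → ℝ) (c : ℝ) (T : ℕ) (b : ℤ) (t : ℕ) (x : ℝ) :
    (ceDecision F T b t x : ℝ)
      = highArrival c x + lowHire F c T b t x - highReject F c T b t x := by
  unfold ceDecision highArrival lowHire highReject
  by_cases h1 : c < x <;> by_cases h2 : ceQuantile T b t ≤ F x <;>
    simp [h1, h2, not_le.2, not_lt.1, not_lt.2, not_le.1]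

lemma ceBudget_succ (F : ℝ → ℝ) (B T : ℕ) (θ : ℕ → ℝ) (t : ℕ) :
    ceBudget F B T θ (t + 1)
      = ceBudget F B T θ t - ceDecision F T (ceBudget F B T θ t) t (θ t) := rfl

lemma surplus_succ (F : ℝ → ℝ) (q : ℝ) (B T : ℕ) (θ : ℕ → ℝ) (t : ℕ) :
    surplus F q B T θ (t + 1)
      = surplus F q B T θ t + q - ceDecision F T (ceBudget F B T θ t) t (θ t) := by
  unfold surplus
  rw [ceBudget_succ]
  push_cast
  ring

/-- Separates the exogenous walk of high arrivals from the policy's own corrections, each of which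
is monotone in time. -/
lemma surplus_eq (F : ℝ → ℝ) (c q : ℝ) (B T : ℕ) (θ : ℕ → ℝ) (t : ℕ) :
    surplus F q B T θ t = (B - T * q) - ∑ s ∈ Finset.range t, (highArrival c (θ s) - q)
      - lowHireCount F c B T θ t + highRejectCount F c B T θ t := by
  induction t with
  | zero => simp [surplus, ceBudget, lowHireCount, highRejectCount]
  | succ t ih =>
    rw [surplus_succ, ih, ceDecision_eq F c, lowHireCount, highRejectCount, lowHireCount,
      highRejectCount, Finset.sum_range_succ, Finset.sum_range_succ _ t,
      Finset.sum_range_succ _ t]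
    ring

lemma lowHireCount_mono (F : ℝ → ℝ) (c : ℝ) (B T : ℕ) (θ : ℕ → ℝ) :
    Monotone (lowHireCount F c B T θ) := fun _ _ h =>
  Finset.sum_le_sum_of_subset_of_nonneg (Finset.range_mono h) fun _ _ _ => lowHire_nonneg ..

lemma highRejectCount_mono (F : ℝ → ℝ) (c : ℝ) (B T : ℕ) (θ : ℕ → ℝ) :
    Monotone (highRejectCount F c B T θ) := fun _ _ h =>
  Finset.sum_le_sum_of_subset_of_nonneg (Finset.range_mono h) fun _ _ _ => highReject_nonneg ..

lemma lowHireCount_nonneg (F : ℝ → ℝ) (c : ℝ) (B T : ℕ) (θ : ℕ → ℝ) (t : ℕ) :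
    0 ≤ lowHireCount F c B T θ t := Finset.sum_nonneg fun _ _ => lowHire_nonneg ..

lemma highRejectCount_nonneg (F : ℝ → ℝ) (c : ℝ) (B T : ℕ) (θ : ℕ → ℝ) (t : ℕ) :
    0 ≤ highRejectCount F c B T θ t := Finset.sum_nonneg fun _ _ => highReject_nonneg ..

lemma dependsOnPast_ceBudget (F : ℝ → ℝ) (B T t : ℕ) :
    DependsOnPast t (fun θ => ceBudget F B T θ t) := by
  induction t with
  | zero => exact fun _ _ _ => rfl
  | succ t ih =>
    intro θ θ' h
    have ih : ceBudget F B T θ t = ceBudget F B T θ' t := ih θ θ' fun s hs => h s (by omega)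
    simp only [ceBudget_succ]
    rw [ih, h t (by omega)]

lemma measurable_intCast_comp {α : Type*} [MeasurableSpace α] {f : α → ℤ} (hf : Measurable f) :
    Measurable fun x => (f x : ℝ) :=
  (measurable_of_countable fun z : ℤ => (z : ℝ)).comp hf

lemma measurable_ceDecision {α : Type*} [MeasurableSpace α] {F : ℝ → ℝ} (hF : Measurable F)
    (T t : ℕ) {b : α → ℤ} {y : α → ℝ} (hb : Measurable b) (hy : Measurable y) :
    Measurable fun a => ceDecision F T (b a) t (y a) := by
  suffices H : Measurable fun p : ℤ × ℝ => ceDecision F T p.1 t p.2 from H.comp (hb.prodMk hy)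
  refine measurable_from_prod_countable_right fun b => ?_
  unfold ceDecision
  have h : MeasurableSet {x | ceQuantile T b t ≤ F x} := measurableSet_le measurable_const hF
  exact Measurable.ite h measurable_const measurable_const

lemma measurable_lowHire {α : Type*} [MeasurableSpace α] {F : ℝ → ℝ} (hF : Measurable F) (c : ℝ)
    (T t : ℕ) {b : α → ℤ} {y : α → ℝ} (hb : Measurable b) (hy : Measurable y) :
    Measurable fun a => lowHire F c T (b a) t (y a) := by
  suffices H : Measurable fun p : ℤ × ℝ => lowHire F c T p.1 t p.2 from H.comp (hb.prodMk hy)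
  refine measurable_from_prod_countable_right fun b => ?_
  unfold lowHire
  have h : MeasurableSet {x | ceQuantile T b t ≤ F x} := measurableSet_le measurable_const hF
  have h' : MeasurableSet {x | x ≤ c ∧ ceQuantile T b t ≤ F x} := measurableSet_Iic.inter h
  exact Measurable.ite h' measurable_const measurable_const

lemma measurable_highReject {α : Type*} [MeasurableSpace α] {F : ℝ → ℝ} (hF : Measurable F) (c : ℝ)
    (T t : ℕ) {b : α → ℤ} {y : α → ℝ} (hb : Measurable b) (hy : Measurable y) :
    Measurable fun a => highReject F c T (b a) t (y a) := by
  suffices H : Measurable fun p : ℤ × ℝ => highReject F c T p.1 t p.2 from H.comp (hb.prodMk hy)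
  refine measurable_from_prod_countable_right fun b => ?_
  unfold highReject
  have h : MeasurableSet {x | F x < ceQuantile T b t} := measurableSet_lt hF measurable_const
  have h' : MeasurableSet {x | c < x ∧ F x < ceQuantile T b t} := measurableSet_Ioi.inter h
  exact Measurable.ite h' measurable_const measurable_const

lemma measurable_highArrival (c : ℝ) : Measurable (highArrival c) :=
  Measurable.ite measurableSet_Ioi measurable_const measurable_const

lemma measurable_ceBudget {F : ℝ → ℝ} (hF : Measurable F) (B T t : ℕ) :
    Measurable fun θ => ceBudget F B T θ t := by
  induction t with
  | zero => exact measurable_const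
  | succ t ih =>
    simp only [ceBudget_succ]
    exact ih.sub (measurable_ceDecision hF T t ih (measurable_pi_apply t))

lemma measurable_cePolicy {F : ℝ → ℝ} (hF : Measurable F) (B T t : ℕ) :
    Measurable fun θ => cePolicy F B T θ t :=
  measurable_ceDecision hF T t (measurable_ceBudget hF B T t) (measurable_pi_apply t)

lemma abs_ceBudget_le (F : ℝ → ℝ) (B T : ℕ) (θ : ℕ → ℝ) (t : ℕ) :
    |ceBudget F B T θ t| ≤ B + t := by
  induction t with
  | zero => simp [ceBudget]
  | succ t ih =>
    rw [ceBudget_succ]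
    rw [abs_le] at ih ⊢
    push_cast
    rcases ceDecision_mem F T (ceBudget F B T θ t) t (θ t) with h | h <;> rw [h] <;>
      constructor <;> linarith

lemma bddMeas_surplus {F : ℝ → ℝ} (hF : Measurable F) (q : ℝ) (B T t : ℕ) :
    BddMeas fun θ => surplus F q B T θ t := by
  have h : BddMeas fun θ => (ceBudget F B T θ t : ℝ) :=
    ⟨measurable_intCast_comp (measurable_ceBudget hF B T t), (B : ℝ) + t, fun θ => by
      have := abs_ceBudget_le F B T θ t
      beta_reduce
      exact_mod_cast this⟩
  unfold surplus
  exact h.sub (BddMeas.const _)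

lemma dependsOnPast_surplus (F : ℝ → ℝ) (q : ℝ) (B T t : ℕ) :
    DependsOnPast t (fun θ => surplus F q B T θ t) := fun θ θ' h => by
  have := dependsOnPast_ceBudget F B T t θ θ' h
  simp only [surplus] at this ⊢
  rw [this]

/-- Once the budget equals the number of remaining candidates, the threshold is 0 and everyone is
hired. -/
lemma ceBudget_le {F : ℝ → ℝ} (hF0 : ∀ x, 0 ≤ F x) {B T : ℕ} (hB : B ≤ T) (θ : ℕ → ℝ) {t : ℕ}
    (ht : t ≤ T) : ceBudget F B T θ t ≤ (T : ℤ) - t := by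
  induction t with
  | zero => simpa [ceBudget] using hB
  | succ t ih =>
    have ih := ih (by omega)
    rw [ceBudget_succ]
    push_cast
    rcases ih.lt_or_eq with h | h
    · rcases ceDecision_mem F T (ceBudget F B T θ t) t (θ t) with h' | h' <;> rw [h'] <;> linarith
    · have h1 : ceDecision F T (ceBudget F B T θ t) t (θ t) = 1 := by
        have hT : (0 : ℝ) < (T : ℝ) - t := by
          have : (t : ℝ) < T := by exact_mod_cast (show t < T by omega)
          linarith
        rw [ceDecision, if_pos]
        rw [ceQuantile, h]
        push_cast
        rw [div_self hT.ne', sub_self]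
        exact hF0 _
      rw [h1, h]; linarith

/-- At budget 0 the threshold is 1, which no candidate reaches; division by zero at `t = T` is
harmless because the numerator is 0. -/
lemma ceBudget_nonneg {F : ℝ → ℝ} {B T : ℕ} {θ : ℕ → ℝ} (hθ : ∀ t, F (θ t) < 1) (t : ℕ) :
    0 ≤ ceBudget F B T θ t := by
  induction t with
  | zero => simp [ceBudget]
  | succ t ih =>
    rw [ceBudget_succ]
    rcases ih.eq_or_lt with h | h
    · rw [← h, ceDecision, if_neg]
      · simp
      · simpa [ceQuantile] using hθ t
    · rcases ceDecision_mem F T (ceBudget F B T θ t) t (θ t) with h' | h' <;> rw [h'] <;> omega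

end Dynamics

/-! ### Conditional error probabilities and mean reversion of the surplus. -/

lemma bddMeas_le_cdf (μ : Measure ℝ) (p : ℝ) :
    BddMeas fun x => if p ≤ cdf μ x then (1 : ℝ) else 0 :=
  ⟨Measurable.ite (measurableSet_le measurable_const (monotone_cdf μ).measurable)
    measurable_const measurable_const, 1, fun x => by beta_reduce; split_ifs <;> simp⟩

/-- The sign of the surplus decides on which side of the gap CE errs, and its size per remaining
candidate is the error probability. -/
lemma cdf_sub_ceQuantile {μ : Measure ℝ} {c q : ℝ} (hq : cdf μ c = 1 - q) (B : ℕ) {T t : ℕ}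
    (ht : t < T)
    (θ : ℕ → ℝ) :
    cdf μ c - ceQuantile T (ceBudget (cdf μ) B T θ t) t
      = surplus (cdf μ) q B T θ t / ((T : ℝ) - t) := by
  have hT : (0 : ℝ) < (T : ℝ) - t := by
    have : (t : ℝ) < T := by exact_mod_cast ht
    linarith
  rw [hq]
  unfold ceQuantile surplus
  field_simp
  ring

section Means

variable {μ : Measure ℝ} [IsProbabilityMeasure μ]

lemma integral_highArrival (c : ℝ) : ∫ x, highArrival c x ∂μ = 1 - cdf μ c := by
  have : highArrival c = (Set.Ioi c).indicator 1 := by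
    funext x; simp [highArrival, Set.indicator_apply]
  rw [this, integral_indicator_one measurableSet_Ioi, measureReal_Ioi_eq]

lemma integral_le_cdf (h : ∀ x, μ {x} = 0) {p : ℝ} (hp0 : 0 ≤ p) (hp1 : p ≤ 1) :
    ∫ x, (if p ≤ cdf μ x then (1 : ℝ) else 0) ∂μ = 1 - p := by
  have : (fun x => if p ≤ cdf μ x then (1 : ℝ) else 0) = {x | p ≤ cdf μ x}.indicator 1 := by
    funext x; simp [Set.indicator_apply]
  rw [this, integral_indicator_one (measurableSet_le measurable_const (monotone_cdf μ).measurable),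
    measureReal_le_cdf h hp0 hp1]

lemma bddMeas_highArrival (c : ℝ) : BddMeas (highArrival c) :=
  ⟨measurable_highArrival c, 1, fun x => by unfold highArrival; split_ifs <;> simp⟩

/-- If the threshold is at most F(c), all high candidates are hired and low hires are the excess of
hires over high arrivals. Otherwise no low candidate qualifies. -/
lemma integral_lowHire (h : ∀ x, μ {x} = 0) (c : ℝ) (T : ℕ) (b : ℤ) (t : ℕ)
    (hp0 : 0 ≤ ceQuantile T b t) (hp1 : ceQuantile T b t ≤ 1) :
    ∫ x, lowHire (cdf μ) c T b t x ∂μ = max (cdf μ c - ceQuantile T b t) 0 := by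
  set p := ceQuantile T b t with hp
  by_cases hc : p ≤ cdf μ c
  · have : ∀ x, lowHire (cdf μ) c T b t x
        = (if p ≤ cdf μ x then (1 : ℝ) else 0) - highArrival c x := fun x => by
      unfold lowHire highArrival
      rw [← hp]
      by_cases hx : c < x
      · have := hc.trans (monotone_cdf μ hx.le)
        simp [hx, not_le.2 hx, this]
      · simp [hx, not_lt.1 hx]
    simp only [this]
    rw [integral_sub ((bddMeas_le_cdf μ p).integrable μ) ((bddMeas_highArrival c).integrable μ),
      integral_le_cdf h hp0 hp1, integral_highArrival, max_eq_left (by linarith)]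
    ring
  · have : ∀ x, lowHire (cdf μ) c T b t x = 0 := fun x => by
      unfold lowHire
      rw [if_neg]
      rintro ⟨h1, h2⟩
      exact hc (h2.trans (monotone_cdf μ h1))
    simp only [this, integral_zero]
    rw [max_eq_right (by linarith)]

lemma integral_highReject (h : ∀ x, μ {x} = 0) (c : ℝ) (T : ℕ) (b : ℤ) (t : ℕ)
    (hp0 : 0 ≤ ceQuantile T b t) (hp1 : ceQuantile T b t ≤ 1) :
    ∫ x, highReject (cdf μ) c T b t x ∂μ = max (ceQuantile T b t - cdf μ c) 0 := by
  set p := ceQuantile T b t with hp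
  by_cases hc : p ≤ cdf μ c
  · have : ∀ x, highReject (cdf μ) c T b t x = 0 := fun x => by
      unfold highReject
      rw [if_neg]
      rintro ⟨h1, h2⟩
      exact absurd (hc.trans (monotone_cdf μ h1.le)) (not_le.2 h2)
    simp only [this, integral_zero]
    rw [max_eq_right (by linarith)]
  · have : ∀ x, highReject (cdf μ) c T b t x
        = highArrival c x - (if p ≤ cdf μ x then (1 : ℝ) else 0) := fun x => by
      unfold highReject highArrival
      rw [← hp]
      by_cases hx : c < x
      · by_cases hpx : p ≤ cdf μ x
        · simp [hx, hpx, not_lt.2 hpx]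
        · simp [hx, hpx, not_le.1 hpx]
      · have : ¬ p ≤ cdf μ x := fun h' => hc (h'.trans (monotone_cdf μ (not_lt.1 hx)))
        simp [hx, this]
    simp only [this]
    rw [integral_sub ((bddMeas_highArrival c).integrable μ) ((bddMeas_le_cdf μ p).integrable μ),
      integral_le_cdf h hp0 hp1, integral_highArrival, max_eq_left (by linarith)]
    ring

lemma integral_ceDecision (h : ∀ x, μ {x} = 0) (T : ℕ) (b : ℤ) (t : ℕ)
    (hp0 : 0 ≤ ceQuantile T b t) (hp1 : ceQuantile T b t ≤ 1) :
    ∫ x, (ceDecision (cdf μ) T b t x : ℝ) ∂μ = 1 - ceQuantile T b t := by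
  rw [← integral_le_cdf h hp0 hp1]
  refine integral_congr_ae (ae_of_all _ fun x => ?_)
  beta_reduce
  unfold ceDecision
  split_ifs <;> simp

lemma ae_abilityLaw_forall {p : ℝ → Prop} (h : ∀ᵐ x ∂μ, p x) :
    ∀ᵐ θ ∂(abilityLaw μ), ∀ t, p (θ t) :=
  ae_all_iff.2 fun t => (measurePreserving_eval_abilityLaw μ t).quasiMeasurePreserving.ae h

lemma ae_ceQuantile_mem (h : ∀ x, μ {x} = 0) {B T : ℕ} (hB : B ≤ T) :
    ∀ᵐ θ ∂(abilityLaw μ), ∀ t < T,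
      0 ≤ ceQuantile T (ceBudget (cdf μ) B T θ t) t ∧
        ceQuantile T (ceBudget (cdf μ) B T θ t) t ≤ 1 := by
  filter_upwards [ae_abilityLaw_forall (ae_cdf_lt_one h)] with θ hθ t ht
  have h0 : (0 : ℝ) ≤ ceBudget (cdf μ) B T θ t := by exact_mod_cast ceBudget_nonneg hθ t
  have h1 : (ceBudget (cdf μ) B T θ t : ℝ) ≤ (T : ℝ) - t := by
    exact_mod_cast ceBudget_le (cdf_nonneg μ) hB θ ht.le
  have hT : (0 : ℝ) < (T : ℝ) - t := by
    have : (t : ℝ) < T := by exact_mod_cast ht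
    linarith
  unfold ceQuantile
  constructor
  · rw [sub_nonneg, div_le_one hT]; exact h1
  · have : 0 ≤ (ceBudget (cdf μ) B T θ t : ℝ) / ((T : ℝ) - t) := by positivity
    linarith

lemma bddMeas_integral_right {Ω : Type*} [MeasurableSpace Ω] {f : Ω → ℝ → ℝ}
    (hf : BddMeas (Function.uncurry f)) : BddMeas fun θ => ∫ x, f θ x ∂μ := by
  obtain ⟨m, C, hC⟩ := hf
  refine ⟨(m.stronglyMeasurable.integral_prod_right').measurable, C, fun θ => ?_⟩
  have h : ∀ x, ‖f θ x‖ ≤ C := fun x => hC (θ, x)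
  simpa using norm_integral_le_of_norm_le_const (μ := μ) (ae_of_all _ h)

lemma bddMeas_ceDecision {F : ℝ → ℝ} (hF : Measurable F) (T : ℕ) (b : ℤ) (t : ℕ) :
    BddMeas fun x => (ceDecision F T b t x : ℝ) := by
  refine ⟨measurable_intCast_comp (measurable_ceDecision hF T t measurable_const measurable_id), 1,
    fun x => ?_⟩
  rcases ceDecision_mem F T b t x with h | h <;> simp [h]

/-- The hiring probability is q + Z/(T - t), so the drift of Z is -Z/(T - t). Its contribution
-2Z²/(T - t) to the square is dropped, and the squared increment is at most 1. -/
lemma integral_surplus_step_le (h : ∀ x, μ {x} = 0) {c q : ℝ} (hq : cdf μ c = 1 - q) (B : ℕ)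
    {T t : ℕ} (ht : t < T) (hq0 : 0 ≤ q) (hq1 : q ≤ 1) (θ : ℕ → ℝ)
    (hp0 : 0 ≤ ceQuantile T (ceBudget (cdf μ) B T θ t) t)
    (hp1 : ceQuantile T (ceBudget (cdf μ) B T θ t) t ≤ 1) :
    ∫ x, (surplus (cdf μ) q B T θ t + q
      - (ceDecision (cdf μ) T (ceBudget (cdf μ) B T θ t) t x : ℝ)) ^ 2 ∂μ
        ≤ surplus (cdf μ) q B T θ t ^ 2 + 1 := by
  have hT : (0 : ℝ) < (T : ℝ) - t := by
    have : (t : ℝ) < T := by exact_mod_cast ht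
    linarith
  have h3 := cdf_sub_ceQuantile hq B ht θ
  set b := ceBudget (cdf μ) B T θ t
  set Z := surplus (cdf μ) q B T θ t
  have bd := bddMeas_ceDecision (monotone_cdf μ).measurable T b t
  have hle : ∀ x, (Z + q - (ceDecision (cdf μ) T b t x : ℝ)) ^ 2
      ≤ (Z ^ 2 + 2 * Z * q + 1) + (-(2 * Z)) * (ceDecision (cdf μ) T b t x : ℝ) := fun x => by
    rcases ceDecision_mem (cdf μ) T b t x with h | h <;> rw [h] <;> push_cast <;> nlinarith
  refine (integral_mono ((((BddMeas.const (Z + q)).sub bd).pow 2).integrable μ)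
    (((BddMeas.const _).add (bd.const_mul _)).integrable μ) hle).trans ?_
  rw [(BddMeas.const _).integral_add (bd.const_mul _), integral_const_mul,
    integral_ceDecision h T b t hp0 hp1]
  have h4 : ceQuantile T b t = 1 - q - Z / ((T : ℝ) - t) := by linarith
  rw [h4]
  simp only [integral_const, probReal_univ, smul_eq_mul, one_mul]
  have h5 : 0 ≤ Z * (Z / ((T : ℝ) - t)) := by
    rw [← mul_div_assoc]; exact div_nonneg (mul_self_nonneg _) hT.le
  linarith

lemma integral_surplus_sq_le (h : ∀ x, μ {x} = 0) {c q : ℝ} (hq : cdf μ c = 1 - q) {B T : ℕ}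
    (hB : B ≤ T) {t : ℕ} (ht : t ≤ T) :
    ∫ θ, surplus (cdf μ) q B T θ t ^ 2 ∂(abilityLaw μ) ≤ (B - T * q) ^ 2 + t := by
  have mF : Measurable (cdf μ) := (monotone_cdf μ).measurable
  have hq0 : 0 ≤ q := by have := cdf_le_one μ c; linarith
  have hq1 : q ≤ 1 := by have := cdf_nonneg μ c; linarith
  induction t with
  | zero => simp [surplus, ceBudget]
  | succ t ih =>
    have ih := ih (by omega)
    have ht' : t < T := by omega
    have bZ := bddMeas_surplus mF q B T t
    have mb := measurable_ceBudget mF B T t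
    have bD : BddMeas fun p : (ℕ → ℝ) × ℝ =>
        (ceDecision (cdf μ) T (ceBudget (cdf μ) B T p.1 t) t p.2 : ℝ) := by
      refine ⟨measurable_intCast_comp (measurable_ceDecision mF T t (mb.comp measurable_fst)
        measurable_snd), 1, fun p => ?_⟩
      rcases ceDecision_mem (cdf μ) T (ceBudget (cdf μ) B T p.1 t) t p.2 with h | h <;> simp [h]
    have b2 : BddMeas (Function.uncurry fun (θ : ℕ → ℝ) (x : ℝ) =>
        (surplus (cdf μ) q B T θ t + q
          - (ceDecision (cdf μ) T (ceBudget (cdf μ) B T θ t) t x : ℝ)) ^ 2) :=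
      (((bZ.comp measurable_fst).add (BddMeas.const q)).sub bD).pow 2
    have key := integral_eval_of_dependsOnPast μ t b2 (fun θ θ' hθ => by
        have e1 := dependsOnPast_surplus (cdf μ) q B T t θ θ' hθ
        have e2 := dependsOnPast_ceBudget (cdf μ) B T t θ θ' hθ
        beta_reduce at e1 e2
        funext x
        rw [e1, e2])
    simp only [surplus_succ]
    rw [key]
    have := integral_mono_ae ((bddMeas_integral_right b2).integrable _)
      (((bZ.pow 2).add (BddMeas.const 1)).integrable (abilityLaw μ)) (by
        filter_upwards [ae_ceQuantile_mem h hB] with θ hθ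
        exact integral_surplus_step_le h hq B ht' hq0 hq1 θ (hθ t ht').1 (hθ t ht').2)
    rw [(bZ.pow 2).integral_add (BddMeas.const 1)] at this
    simp only [integral_const, probReal_univ, smul_eq_mul, one_mul] at this
    push_cast
    linarith

end Means

/-! ### Fluctuation of error counts about their compensators. -/

section Noise

variable {μ : Measure ℝ} [IsProbabilityMeasure μ]

/-- The arithmetic-geometric mean inequality |N| ≤ (l + N²/l)/2, integrated; the free `l` replaces a
square root of the second moment. -/
lemma integral_abs_le_of_sq {Ω : Type*} [MeasurableSpace Ω] (P : Measure Ω)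
    [IsProbabilityMeasure P] {N : Ω → ℝ} (hN : BddMeas N) {l : ℝ} (hl : 0 < l) :
    ∫ ω, |N ω| ∂P ≤ (l + (∫ ω, N ω ^ 2 ∂P) / l) / 2 := by
  have h : ∀ ω, |N ω| ≤ l / 2 + 1 / (2 * l) * N ω ^ 2 := fun ω => by
    have e : l / 2 + 1 / (2 * l) * N ω ^ 2 - |N ω| = (l - |N ω|) ^ 2 / (2 * l) := by
      rw [← sq_abs (N ω)]; field_simp; ring
    have : 0 ≤ (l - |N ω|) ^ 2 / (2 * l) := by positivity
    linarith
  refine (integral_mono (hN.abs.integrable P)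
    (((BddMeas.const _).add ((hN.pow 2).const_mul _)).integrable P) h).trans (le_of_eq ?_)
  rw [(BddMeas.const _).integral_add ((hN.pow 2).const_mul _), integral_const_mul]
  simp only [integral_const, probReal_univ, smul_eq_mul, one_mul]
  field_simp

/-- A counting process of CE decisions stays close to its compensator. -/
lemma integral_sq_compensated_le (h : ∀ x, μ {x} = 0) {c q : ℝ} (hq : cdf μ c = 1 - q) {B T : ℕ}
    (hB : B ≤ T) (hz : (B - T * q) ^ 2 ≤ 1) {H : ℤ → ℕ → ℝ → ℝ} {φ : ℝ → ℝ}
    (H01 : ∀ b t x, H b t x = 0 ∨ H b t x = 1)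
    (mH : ∀ t, Measurable fun p : ℤ × ℝ => H p.1 t p.2) (mφ : Measurable φ)
    (φ0 : ∀ z, 0 ≤ φ z) (φ1 : ∀ z, φ z ≤ |z|)
    (mean : ∀ t < T, ∀ θ, 0 ≤ ceQuantile T (ceBudget (cdf μ) B T θ t) t →
      ceQuantile T (ceBudget (cdf μ) B T θ t) t ≤ 1 →
      ∫ x, H (ceBudget (cdf μ) B T θ t) t x ∂μ = φ (surplus (cdf μ) q B T θ t) / ((T : ℝ) - t))
    {n : ℕ} (hn : 2 * n ≤ T) :
    ∫ θ, (∑ t ∈ Finset.range n, (H (ceBudget (cdf μ) B T θ t) t (θ t)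
      - φ (surplus (cdf μ) q B T θ t) / ((T : ℝ) - t))) ^ 2 ∂(abilityLaw μ) ≤ √T := by
  rcases Nat.eq_zero_or_pos n with rfl | hn0
  · simp
  have mF : Measurable (cdf μ) := (monotone_cdf μ).measurable
  have hT2 : (2 : ℝ) * n ≤ T := by exact_mod_cast hn
  have hn1 : (1 : ℝ) ≤ n := by exact_mod_cast hn0
  have hT0 : (0 : ℝ) < T := by linarith
  have bφ : ∀ t, BddMeas fun θ => φ (surplus (cdf μ) q B T θ t) / ((T : ℝ) - t) := fun t => by
    obtain ⟨m, C, hC⟩ := bddMeas_surplus mF q B T t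
    have : BddMeas fun θ => φ (surplus (cdf μ) q B T θ t) := ⟨mφ.comp m, C, fun θ => by
      rw [abs_of_nonneg (φ0 _)]
      exact (φ1 _).trans (hC θ)⟩
    simp only [div_eq_mul_inv]
    exact this.mul (BddMeas.const _)
  have bH : ∀ b t, BddMeas (H b t) := fun b t =>
    ⟨(mH t).comp (measurable_const.prodMk measurable_id), 1, fun x => by
      rcases H01 b t x with h | h <;> simp [h]⟩
  set D : ℕ → (ℕ → ℝ) → ℝ → ℝ := fun t θ x => H (ceBudget (cdf μ) B T θ t) t x
    - φ (surplus (cdf μ) q B T θ t) / ((T : ℝ) - t) with hD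
  have bD : ∀ t, BddMeas (Function.uncurry (D t)) := fun t => by
    have h1 : BddMeas fun p : (ℕ → ℝ) × ℝ => H (ceBudget (cdf μ) B T p.1 t) t p.2 :=
      ⟨(mH t).comp (((measurable_ceBudget mF B T t).comp measurable_fst).prodMk measurable_snd), 1,
        fun p => by rcases H01 (ceBudget (cdf μ) B T p.1 t) t p.2 with h | h <;> simp [h]⟩
    exact h1.sub ((bφ t).comp measurable_fst)
  have pD : ∀ t, DependsOnPast t (D t) := fun t θ θ' hθ => by
    have e1 := dependsOnPast_surplus (cdf μ) q B T t θ θ' hθ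
    have e2 := dependsOnPast_ceBudget (cdf μ) B T t θ θ' hθ
    beta_reduce at e1 e2
    simp only [hD, e1, e2]
  have meanD : ∀ t < T, ∀ᵐ θ ∂(abilityLaw μ), ∫ x, D t θ x ∂μ = 0 ∧
      ∫ x, D t θ x ^ 2 ∂μ ≤ φ (surplus (cdf μ) q B T θ t) / ((T : ℝ) - t) := fun t ht => by
    filter_upwards [ae_ceQuantile_mem h hB] with θ hθ
    have hm := mean t ht θ (hθ t ht).1 (hθ t ht).2
    simp only [hD]
    set a := φ (surplus (cdf μ) q B T θ t) / ((T : ℝ) - t)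
    set b := ceBudget (cdf μ) B T θ t
    constructor
    · rw [integral_sub ((bH b t).integrable μ) ((BddMeas.const _).integrable μ), hm]
      simp
    -- A 0-1 variable of mean a has variance a - a² ≤ a.
    · have e : ∀ x, (H b t x - a) ^ 2 = (1 - 2 * a) * H b t x + a ^ 2 := fun x => by
        rcases H01 b t x with h | h <;> rw [h] <;> ring
      simp only [e]
      rw [((bH b t).const_mul _).integral_add (BddMeas.const _), integral_const_mul, hm]
      simp only [integral_const, probReal_univ, smul_eq_mul, one_mul]
      nlinarith [sq_nonneg a]
  have key := integral_sq_sum_martingaleDiff μ (D := D) n (fun t _ => bD t) (fun t _ => pD t)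
    (fun t ht => (meanD t (by omega)).mono fun _ h => h.1)
  rw [key]
  -- In the first half of the horizon the error rate is at most (2/T)|Z|, and E|Z| ≤ √T because E Z²
  -- ≤ 1 + t ≤ T.
  have each : ∀ t ∈ Finset.range n, ∫ θ, (∫ x, D t θ x ^ 2 ∂μ) ∂(abilityLaw μ) ≤ 2 / T * √T := by
    intro t ht
    have htn := Finset.mem_range.1 ht
    have htn' : (t : ℝ) + 1 ≤ n := by exact_mod_cast htn
    have hTt : (0 : ℝ) < (T : ℝ) - t := by linarith
    have bZ := bddMeas_surplus mF q B T t
    have b2 : BddMeas (Function.uncurry fun (θ : ℕ → ℝ) (x : ℝ) => D t θ x ^ 2) := (bD t).pow 2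
    refine (integral_mono_ae ((bddMeas_integral_right b2).integrable _)
      ((bZ.abs.const_mul (2 / T)).integrable _) ?_).trans ?_
    · filter_upwards [meanD t (by omega)] with θ hθ
      refine hθ.2.trans ?_
      rw [div_eq_mul_inv, mul_comm]
      have : ((T : ℝ) - t)⁻¹ ≤ 2 / T := by
        rw [inv_eq_one_div, div_le_div_iff₀ hTt hT0]; linarith
      exact mul_le_mul this (φ1 _) (φ0 _) (by positivity)
    · rw [integral_const_mul]
      refine mul_le_mul_of_nonneg_left ?_ (by positivity)
      refine (integral_abs_le_of_sq (abilityLaw μ) bZ (Real.sqrt_pos.2 hT0)).trans ?_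
      have h2 := integral_surplus_sq_le h hq hB (t := t) (by omega)
      have h3 : (∫ θ, surplus (cdf μ) q B T θ t ^ 2 ∂(abilityLaw μ)) / √T ≤ √T := by
        rw [div_le_iff₀ (Real.sqrt_pos.2 hT0), Real.mul_self_sqrt hT0.le]
        linarith
      linarith
  refine (Finset.sum_le_sum each).trans ?_
  rw [Finset.sum_const, Finset.card_range, nsmul_eq_mul]
  have : (n : ℝ) * (2 / T) ≤ 1 := by
    rw [mul_div_assoc', div_le_one hT0]; linarith
  nlinarith [Real.sqrt_nonneg (T : ℝ)]

end Noise

/-! ### From the walk to wrong decisions of both kinds. -/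

/-- Pathwise comparison of the two kinds of wrong decisions with averages of the walk of high
arrivals, up to the compensated counts. -/
lemma min_counts_ge (F : ℝ → ℝ) (c q : ℝ) {B T : ℕ} (θ : ℕ → ℝ) (hz0 : 0 ≤ B - T * q)
    (hz1 : B - T * q ≤ 1) {n m : ℕ} (hnm : n + m < T) :
    min (max (-∑ t ∈ Finset.range n, ∑ s ∈ Finset.range t, (highArrival c (θ s) - q)) 0)
        (max (∑ t ∈ Finset.range m, ∑ s ∈ Finset.range (n + t), (highArrival c (θ s) - q)) 0) / T
      - 1
      - |∑ t ∈ Finset.range n, (lowHire F c T (ceBudget F B T θ t) t (θ t)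
          - max (surplus F q B T θ t) 0 / ((T : ℝ) - t))|
      - |∑ t ∈ Finset.range (n + m), (highReject F c T (ceBudget F B T θ t) t (θ t)
          - max (-surplus F q B T θ t) 0 / ((T : ℝ) - t))|
      ≤ 2 * min (lowHireCount F c B T θ (n + m)) (highRejectCount F c B T θ (n + m)) := by
  have hT0 : (0 : ℝ) < T := by exact_mod_cast (show 0 < T by omega)
  have hnR : (n : ℝ) ≤ T := by exact_mod_cast (show n ≤ T by omega)
  have hmR : (m : ℝ) ≤ T := by exact_mod_cast (show m ≤ T by omega)
  set Sw : ℕ → ℝ := fun t => ∑ s ∈ Finset.range t, (highArrival c (θ s) - q)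
  set Z : ℕ → ℝ := surplus F q B T θ
  set A : ℕ → ℝ := lowHireCount F c B T θ with hA
  set R : ℕ → ℝ := highRejectCount F c B T θ with hR
  have hZ : ∀ t, Z t = (B - T * q) - Sw t - A t + R t := surplus_eq F c q B T θ
  have A0 : ∀ t, 0 ≤ A t := lowHireCount_nonneg F c B T θ
  have R0 : ∀ t, 0 ≤ R t := highRejectCount_nonneg F c B T θ
  have Am : Monotone A := lowHireCount_mono F c B T θ
  have Rm : Monotone R := highRejectCount_mono F c B T θ
  rw [Finset.sum_sub_distrib, Finset.sum_sub_distrib]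
  change _ - 1 - |A n - _| - |R (n + m) - _| ≤ _
  set cA := ∑ t ∈ Finset.range n, max (Z t) 0 / ((T : ℝ) - t)
  set cR := ∑ t ∈ Finset.range (n + m), max (-Z t) 0 / ((T : ℝ) - t)
  -- compensators dominate the positive parts divided by the horizon
  have dom : ∀ (y z : ℝ) (t : ℕ), t < T → y ≤ z → y / T ≤ max z 0 / ((T : ℝ) - t) := by
    intro y z t ht hyz
    have ht' : (t : ℝ) < T := by exact_mod_cast ht
    calc y / T ≤ max z 0 / T := by
          gcongr; exact hyz.trans (le_max_left _ _)
      _ ≤ max z 0 / ((T : ℝ) - t) :=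
          div_le_div_of_nonneg_left (le_max_right _ _) (by linarith) (by
            have : (0 : ℝ) ≤ t := Nat.cast_nonneg t
            linarith)
  -- Up to time `n`, earlier low hires lower the surplus by at most `A n`, while high rejections
  -- only raise it. With `cA` close to `A n`, this bounds 2 `A n` from below.
  have low : (-∑ t ∈ Finset.range n, Sw t) / T - A n ≤ cA := by
    have h1 : ∑ t ∈ Finset.range n, (-Sw t - A n) / T ≤ cA := by
      refine Finset.sum_le_sum fun t ht => ?_
      have ht := Finset.mem_range.1 ht
      refine dom _ _ t (by omega) ?_
      have := hZ t
      have := Am ht.le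
      have := R0 t
      linarith
    rw [← Finset.sum_div, Finset.sum_sub_distrib, Finset.sum_neg_distrib, Finset.sum_const,
      Finset.card_range, nsmul_eq_mul, sub_div] at h1
    have h2 : (n : ℝ) * A n / T ≤ A n := by
      rw [div_le_iff₀ hT0]; nlinarith [A0 n]
    linarith
  -- Mirror image on the second stretch: low hires only help, and the extra 1 pays for the initial
  -- surplus B - Tq.
  have high : (∑ t ∈ Finset.range m, Sw (n + t)) / T - 1 - R (n + m) ≤ cR := by
    have h1 : ∑ t ∈ Finset.range m, (Sw (n + t) - (1 + R (n + m))) / T ≤ cR := by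
      have h0 : ∑ t ∈ Finset.range m, max (-Z (n + t)) 0 / ((T : ℝ) - (n + t : ℕ)) ≤ cR := by
        simp only [cR]
        rw [Finset.sum_range_add]
        refine le_add_of_nonneg_left (Finset.sum_nonneg fun t ht => ?_)
        have := dom 0 0 t (by have := Finset.mem_range.1 ht; omega) le_rfl
        have ht' : (t : ℝ) < T := by
          exact_mod_cast (show t < T by have := Finset.mem_range.1 ht; omega)
        exact div_nonneg (le_max_right _ _) (by linarith)
      refine le_trans (Finset.sum_le_sum fun t ht => ?_) h0
      have ht := Finset.mem_range.1 ht
      refine dom _ _ (n + t) (by omega) ?_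
      have := hZ (n + t)
      have := Rm (show n + t ≤ n + m by omega)
      have := A0 (n + t)
      linarith
    rw [← Finset.sum_div, Finset.sum_sub_distrib, Finset.sum_const,
      Finset.card_range, nsmul_eq_mul, sub_div] at h1
    have h2 : (m : ℝ) * (1 + R (n + m)) / T ≤ 1 + R (n + m) := by
      rw [div_le_iff₀ hT0]; nlinarith [R0 (n + m)]
    linarith
  set X := -∑ t ∈ Finset.range n, Sw t
  set Y := ∑ t ∈ Finset.range m, Sw (n + t)
  have hXY1 : min (max X 0) (max Y 0) / T ≤ max (X / T) 0 := by
    rw [div_le_iff₀ hT0]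
    refine (min_le_left _ _).trans (max_le ?_ (by positivity))
    rw [← div_le_iff₀ hT0]; exact le_max_left _ _
  have hXY2 : min (max X 0) (max Y 0) / T ≤ max (Y / T) 0 := by
    rw [div_le_iff₀ hT0]
    refine (min_le_right _ _).trans (max_le ?_ (by positivity))
    rw [← div_le_iff₀ hT0]; exact le_max_left _ _
  have nA := neg_abs_le (A n - cA)
  have nR := neg_abs_le (R (n + m) - cR)
  have nA0 := abs_nonneg (A n - cA)
  have nR0 := abs_nonneg (R (n + m) - cR)
  have hAm := Am (show n ≤ n + m by omega)
  have hA0 := A0 (n + m)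
  have hR0 := R0 (n + m)
  rw [mul_min_of_nonneg _ _ (zero_le_two)]
  refine le_min ?_ ?_
  · rcases max_cases (X / T) 0 with ⟨h, -⟩ | ⟨h, -⟩ <;> rw [h] at hXY1 <;> linarith
  · rcases max_cases (Y / T) 0 with ⟨h, -⟩ | ⟨h, -⟩ <;> rw [h] at hXY2 <;> linarith

lemma bddMeas_lowHireCount {F : ℝ → ℝ} (hF : Measurable F) (c : ℝ) (B T t : ℕ) :
    BddMeas fun θ => lowHireCount F c B T θ t :=
  BddMeas.sum _ fun s _ => ⟨measurable_lowHire hF c T s (measurable_ceBudget hF B T s)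
    (measurable_pi_apply s), 1, fun θ => by
      rcases lowHire_mem F c T (ceBudget F B T θ s) s (θ s) with h | h <;> simp [h]⟩

lemma bddMeas_highRejectCount {F : ℝ → ℝ} (hF : Measurable F) (c : ℝ) (B T t : ℕ) :
    BddMeas fun θ => highRejectCount F c B T θ t :=
  BddMeas.sum _ fun s _ => ⟨measurable_highReject hF c T s (measurable_ceBudget hF B T s)
    (measurable_pi_apply s), 1, fun θ => by
      rcases highReject_mem F c T (ceBudget F B T θ s) s (θ s) with h | h <;> simp [h]⟩

lemma integral_min_counts_ge {μ : Measure ℝ} [IsProbabilityMeasure μ] (h : ∀ x, μ {x} = 0)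
    {c q : ℝ} (hq : cdf μ c = 1 - q) {B T : ℕ} (hB : B ≤ T) (hz0 : 0 ≤ B - T * q)
    (hz1 : B - T * q ≤ 1) {n m : ℕ} (hnm : 2 * (n + m) ≤ T) (hT : 0 < T) {l : ℝ} (hl : 0 < l) :
    (∫ θ, min (max (-∑ t ∈ Finset.range n, ∑ s ∈ Finset.range t, (highArrival c (θ s) - q)) 0)
        (max (∑ t ∈ Finset.range m, ∑ s ∈ Finset.range (n + t), (highArrival c (θ s) - q)) 0)
        ∂(abilityLaw μ)) / T - 1 - (l + √T / l)
      ≤ 2 * ∫ θ, min (lowHireCount (cdf μ) c B T θ T) (highRejectCount (cdf μ) c B T θ T)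
        ∂(abilityLaw μ) := by
  have mF : Measurable (cdf μ) := (monotone_cdf μ).measurable
  have hz : (B - T * q) ^ 2 ≤ 1 := by nlinarith
  have bξ : BddMeas fun x => highArrival c x - q := (bddMeas_highArrival c).sub (BddMeas.const _)
  have bX : ∀ t, BddMeas fun θ : ℕ → ℝ => ∑ s ∈ Finset.range t, (highArrival c (θ s) - q) :=
    fun t => BddMeas.sum _ fun s _ => bξ.comp (φ := fun θ : ℕ → ℝ => θ s) (by fun_prop)
  have bXn : BddMeas fun θ : ℕ → ℝ =>
      -∑ t ∈ Finset.range n, ∑ s ∈ Finset.range t, (highArrival c (θ s) - q) := by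
    have := (BddMeas.sum (Finset.range n) fun t _ => bX t).const_mul (-1)
    simpa only [neg_one_mul] using this
  have bY : BddMeas fun θ : ℕ → ℝ =>
      ∑ t ∈ Finset.range m, ∑ s ∈ Finset.range (n + t), (highArrival c (θ s) - q) :=
    BddMeas.sum (Finset.range m) fun t _ => bX (n + t)
  have bM := (bXn.max (BddMeas.const 0)).min (bY.max (BddMeas.const 0))
  have bZ : ∀ (φ : ℝ → ℝ) (t : ℕ), Measurable φ → (∀ z, |φ z| ≤ |z|) →
      BddMeas fun θ => φ (surplus (cdf μ) q B T θ t) / ((T : ℝ) - t) := fun φ t mφ hφ => by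
    obtain ⟨m, C, hC⟩ := bddMeas_surplus mF q B T t
    have : BddMeas fun θ => φ (surplus (cdf μ) q B T θ t) :=
      ⟨mφ.comp m, C, fun θ => (hφ _).trans (hC θ)⟩
    simp only [div_eq_mul_inv]
    exact this.mul (BddMeas.const _)
  have hpos : ∀ z : ℝ, |max z 0| ≤ |z| := fun z => by
    rw [abs_of_nonneg (le_max_right z 0)]; exact max_le (le_abs_self z) (abs_nonneg z)
  have hneg : ∀ z : ℝ, |max (-z) 0| ≤ |z| := fun z => by simpa using hpos (-z)
  have mpos : Measurable fun z : ℝ => max z 0 := by fun_prop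
  have mneg : Measurable fun z : ℝ => max (-z) 0 := by fun_prop
  set NA : (ℕ → ℝ) → ℝ := fun θ => ∑ t ∈ Finset.range n,
    (lowHire (cdf μ) c T (ceBudget (cdf μ) B T θ t) t (θ t)
      - max (surplus (cdf μ) q B T θ t) 0 / ((T : ℝ) - t)) with hNA
  set NR : (ℕ → ℝ) → ℝ := fun θ => ∑ t ∈ Finset.range (n + m),
    (highReject (cdf μ) c T (ceBudget (cdf μ) B T θ t) t (θ t)
      - max (-surplus (cdf μ) q B T θ t) 0 / ((T : ℝ) - t)) with hNR
  have bNA : BddMeas NA := by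
    simp only [hNA, Finset.sum_sub_distrib]
    exact (bddMeas_lowHireCount mF c B T n).sub
      (BddMeas.sum _ fun t _ => bZ (fun z => max z 0) t mpos hpos)
  have bNR : BddMeas NR := by
    simp only [hNR, Finset.sum_sub_distrib]
    exact (bddMeas_highRejectCount mF c B T (n + m)).sub
      (BddMeas.sum _ fun t _ => bZ (fun z => max (-z) 0) t mneg hneg)
  have sNA : ∫ θ, NA θ ^ 2 ∂(abilityLaw μ) ≤ √T := by
    refine integral_sq_compensated_le h hq hB hz (H := lowHire (cdf μ) c T)
      (φ := fun z => max z 0) (lowHire_mem (cdf μ) c T)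
      (fun t => measurable_lowHire mF c T t measurable_fst measurable_snd) mpos
      (fun z => le_max_right _ _) (fun z => (le_abs_self _).trans (hpos z)) ?_ (by omega)
    intro t ht θ hp0 hp1
    have hTt : (0 : ℝ) < (T : ℝ) - t := by
      have : (t : ℝ) < T := by exact_mod_cast ht
      linarith
    rw [integral_lowHire h c T _ t hp0 hp1, cdf_sub_ceQuantile hq B ht θ,
      ← max_div_div_right hTt.le, zero_div]
  have sNR : ∫ θ, NR θ ^ 2 ∂(abilityLaw μ) ≤ √T := by
    refine integral_sq_compensated_le h hq hB hz (H := highReject (cdf μ) c T)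
      (φ := fun z => max (-z) 0) (highReject_mem (cdf μ) c T)
      (fun t => measurable_highReject mF c T t measurable_fst measurable_snd) mneg
      (fun z => le_max_right _ _) (fun z => (le_abs_self _).trans (hneg z)) ?_ (by omega)
    intro t ht θ hp0 hp1
    have hTt : (0 : ℝ) < (T : ℝ) - t := by
      have : (t : ℝ) < T := by exact_mod_cast ht
      linarith
    rw [integral_highReject h c T _ t hp0 hp1, ← neg_sub (cdf μ c), cdf_sub_ceQuantile hq B ht θ,
      ← neg_div, ← max_div_div_right hTt.le, zero_div]
  have aNA := integral_abs_le_of_sq (abilityLaw μ) bNA hl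
  have aNR := integral_abs_le_of_sq (abilityLaw μ) bNR hl
  have bmin : BddMeas fun θ => min (lowHireCount (cdf μ) c B T θ T)
      (highRejectCount (cdf μ) c B T θ T) :=
    (bddMeas_lowHireCount mF c B T T).min (bddMeas_highRejectCount mF c B T T)
  have b0 := bM.const_mul (T : ℝ)⁻¹
  have b1 := b0.sub (BddMeas.const 1)
  have b2 := b1.sub bNA.abs
  have main := integral_mono ((b2.sub bNR.abs).integrable (abilityLaw μ))
    ((bmin.const_mul 2).integrable _) (fun θ => by
      have h1 := min_counts_ge (cdf μ) c q θ hz0 hz1 (show n + m < T by omega)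
      have h2 : min (lowHireCount (cdf μ) c B T θ (n + m)) (highRejectCount (cdf μ) c B T θ (n + m))
          ≤ min (lowHireCount (cdf μ) c B T θ T) (highRejectCount (cdf μ) c B T θ T) :=
        min_le_min (lowHireCount_mono _ c B T θ (by omega))
          (highRejectCount_mono _ c B T θ (by omega))
      rw [div_eq_inv_mul] at h1
      exact h1.trans (mul_le_mul_of_nonneg_left h2 zero_le_two))
  rw [integral_sub (b2.integrable _) (bNR.abs.integrable _), integral_sub (b1.integrable _)
    (bNA.abs.integrable _), integral_sub (b0.integrable _) ((BddMeas.const 1).integrable _),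
    integral_const_mul, integral_const_mul, ← div_eq_inv_mul] at main
  simp only [integral_const, probReal_univ, smul_eq_mul, one_mul] at main
  have d1 : (∫ θ, NA θ ^ 2 ∂(abilityLaw μ)) / l ≤ √T / l := by gcongr
  have d2 : (∫ θ, NR θ ^ 2 ∂(abilityLaw μ)) / l ≤ √T / l := by gcongr
  linarith

/-- For a suitable budget the CE rule makes, in expectation, order `√T` wrong decisions of both
kinds. -/
lemma exists_budget_min_counts_ge (ε : ℝ) (hε : 0 < ε) :
    ∃ T₀ : ℕ, ∃ C : ℝ, 0 < C ∧ ∀ (μ : Measure ℝ) [IsProbabilityMeasure μ], (∀ x, μ {x} = 0) →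
      ∀ c : ℝ, ε ≤ cdf μ c → ε ≤ 1 - cdf μ c → ∀ T : ℕ, T₀ ≤ T → ∃ B : ℕ, 1 ≤ B ∧ B ≤ T ∧
        C * √T ≤ ∫ θ, min (lowHireCount (cdf μ) c B T θ T) (highRejectCount (cdf μ) c B T θ T)
          ∂(abilityLaw μ) := by
  -- The increments have variance q(1 - q) ≥ ε(1 - ε) ≥ ε/2.
  obtain ⟨κ, hκ, c₀, hc₀, walk⟩ := exists_walk_sign_change (ε / 2) (by positivity)
  -- With n = ⌊T/M⌋ the two stretches, of total length (1 + κ)n, fit into the first half of the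
  -- horizon.
  set M : ℕ := 2 * (1 + κ) with hM
  have hM0 : 0 < M := by omega
  have hMR : (0 : ℝ) < M := by exact_mod_cast hM0
  set c₁ := c₀ / (2 * M * √(2 * M)) with hc₁
  have hc₁0 : 0 < c₁ := by positivity
  -- With l = 4/c₁ the noise is l + (c₁/4)√T. For T ≥ N also 1 + l ≤ (c₁/4)√T, so half of the main
  -- term c₁√T survives.
  obtain ⟨N, hN⟩ := exists_nat_ge (((1 + 4 / c₁) * (4 / c₁)) ^ 2)
  refine ⟨max (2 * M) N, c₁ / 4, by positivity, ?_⟩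
  intro μ _ hμ c hc hc' T hT
  have hTM : 2 * M ≤ T := (le_max_left _ _).trans hT
  have hTN : N ≤ T := (le_max_right _ _).trans hT
  have hT0 : 0 < T := by omega
  have hTR : (0 : ℝ) < T := by exact_mod_cast hT0
  set q := 1 - cdf μ c with hq
  have hq' : cdf μ c = 1 - q := by rw [hq]; ring
  clear_value q
  have hBle : ⌈(T : ℝ) * q⌉₊ ≤ T := by
    rw [Nat.ceil_le]
    nlinarith
  have hBge : 1 ≤ ⌈(T : ℝ) * q⌉₊ := Nat.one_le_ceil_iff.2 (by nlinarith)
  refine ⟨⌈(T : ℝ) * q⌉₊, hBge, hBle, ?_⟩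
  set n := T / M with hn
  have hn2 : 2 ≤ n := (Nat.le_div_iff_mul_le hM0).2 hTM
  have hnT : n * M ≤ T := Nat.div_mul_le_self T M
  have hnT' : T < (n + 1) * M := by
    have := Nat.lt_mul_div_succ T hM0
    rwa [mul_comm] at this
  have hn0 : (0 : ℝ) < n := by exact_mod_cast (show 0 < n by omega)
  have hnR : (T : ℝ) / (2 * M) ≤ n := by
    rw [div_le_iff₀ (by positivity)]
    have : T ≤ n * (2 * M) := by nlinarith
    exact_mod_cast this
  have hz0 : (0 : ℝ) ≤ ⌈(T : ℝ) * q⌉₊ - T * q := sub_nonneg.2 (Nat.le_ceil _)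
  have hz1 : (⌈(T : ℝ) * q⌉₊ : ℝ) - T * q ≤ 1 := by
    have := Nat.ceil_lt_add_one (show 0 ≤ (T : ℝ) * q by nlinarith)
    linarith
  have hq0 : 0 ≤ q := by linarith
  have hq1 : q ≤ 1 := by linarith
  have bh := bddMeas_highArrival c
  have h01 : ∀ x, highArrival c x = 0 ∨ highArrival c x = 1 := fun x => by
    unfold highArrival; split_ifs <;> simp
  have int1 : ∫ x, highArrival c x ∂μ = q := by rw [integral_highArrival, hq']; ring
  have walk := walk μ (fun x => highArrival c x - q) (bh.sub (BddMeas.const q)).1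
    (fun x => by
      rcases h01 x with h | h <;> rw [h, abs_le] <;> constructor <;> linarith)
    (by rw [integral_sub (bh.integrable μ) ((BddMeas.const q).integrable μ), int1]; simp)
    (by
      have e : ∀ x, (highArrival c x - q) ^ 2 = (1 - 2 * q) * highArrival c x + q ^ 2 := fun x => by
        rcases h01 x with h | h <;> rw [h] <;> ring
      simp only [e]
      rw [(bh.const_mul _).integral_add (BddMeas.const _), integral_const_mul, int1]
      simp only [integral_const, probReal_univ, smul_eq_mul, one_mul]
      have : 0 ≤ (q - ε) * (1 - q - ε) := mul_nonneg (by linarith) (by linarith)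
      nlinarith) n hn2
  have main := integral_min_counts_ge hμ hq' hBle hz0 hz1 (n := n) (m := κ * n)
    (by rw [hM] at hnT; nlinarith) hT0 (l := 4 / c₁) (by positivity)
  have lead : c₁ * √T ≤ c₀ * (n * √n) / T := by
    have h1 : √T / √(2 * M) ≤ √n := by
      rw [← Real.sqrt_div hTR.le]; exact Real.sqrt_le_sqrt hnR
    rw [le_div_iff₀ hTR]
    calc c₁ * √T * T = c₀ * (T / (2 * M) * (√T / √(2 * M))) := by
          rw [hc₁]; field_simp
      _ ≤ c₀ * (n * √n) := by gcongr
  have hs : (1 + 4 / c₁) * (4 / c₁) ≤ √T :=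
    Real.le_sqrt_of_sq_le (hN.trans (by exact_mod_cast hTN))
  have hs' : 1 + 4 / c₁ ≤ c₁ / 4 * √T := by
    have := mul_le_mul_of_nonneg_left hs (show 0 ≤ c₁ / 4 by positivity)
    calc 1 + 4 / c₁ = c₁ / 4 * ((1 + 4 / c₁) * (4 / c₁)) := by field_simp
      _ ≤ _ := this
  have hl : √T / (4 / c₁) = c₁ / 4 * √T := by field_simp
  have hw := div_le_div_of_nonneg_right walk hTR.le
  rw [hl] at main
  linarith

/-! ### Exchange across the gap and the regret bound. -/

lemma sum_cePolicy (F : ℝ → ℝ) (B T : ℕ) (θ : ℕ → ℝ) (t : ℕ) :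
    ∑ s ∈ Finset.range t, cePolicy F B T θ s = B - ceBudget F B T θ t := by
  induction t with
  | zero => simp [ceBudget]
  | succ t ih => rw [Finset.sum_range_succ, ih, ceBudget_succ, cePolicy]; ring

lemma cePolicy_mem (F : ℝ → ℝ) (B T : ℕ) (θ : ℕ → ℝ) (t : ℕ) :
    cePolicy F B T θ t = 0 ∨ cePolicy F B T θ t = 1 := ceDecision_mem ..

/-- Exchanging low hires for high rejects across a gap of length `η` gains `η` per exchange. -/
lemma cePolicy_add_gap_le_offlineReward {F : ℝ → ℝ} {B T : ℕ} {θ : ℕ → ℝ} {c η : ℝ}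
    (hF : ∀ t, F (θ t) < 1) (hgap : ∀ t, θ t ∉ Set.Ioo c (c + η)) :
    ∑ t ∈ Finset.range T, θ t * (cePolicy F B T θ t : ℝ)
      + η * min (lowHireCount F c B T θ T) (highRejectCount F c B T θ T)
      ≤ offlineReward B T θ := by
  classical
  set H := (Finset.range T).filter fun t => cePolicy F B T θ t = 1 with hH
  set L := (Finset.range T).filter fun t =>
    θ t ≤ c ∧ ceQuantile T (ceBudget F B T θ t) t ≤ F (θ t) with hL
  set E := (Finset.range T).filter fun t =>
    c < θ t ∧ F (θ t) < ceQuantile T (ceBudget F B T θ t) t with hE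
  have cL : lowHireCount F c B T θ T = L.card := by
    rw [lowHireCount, hL]
    simp only [lowHire, Finset.sum_boole]
  have cE : highRejectCount F c B T θ T = E.card := by
    rw [highRejectCount, hE]
    simp only [highReject, Finset.sum_boole]
  have hLH : L ⊆ H := fun t ht => by
    rw [hL, Finset.mem_filter] at ht
    rw [hH, Finset.mem_filter]
    refine ⟨ht.1, ?_⟩
    rw [cePolicy, ceDecision, if_pos ht.2.2]
  have hEH : Disjoint E H := by
    rw [Finset.disjoint_left]
    intro t ht hth
    rw [hE, Finset.mem_filter] at ht
    rw [hH, Finset.mem_filter, cePolicy, ceDecision, if_neg (not_le.2 ht.2.2)] at hth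
    exact absurd hth.2 (by norm_num)
  have cH : H.card ≤ B := by
    have h1 : (H.card : ℤ) = ∑ t ∈ Finset.range T, cePolicy F B T θ t := by
      rw [hH, Finset.card_filter]
      push_cast
      refine Finset.sum_congr rfl fun t _ => ?_
      rcases cePolicy_mem F B T θ t with h | h <;> simp [h]
    have h2 := ceBudget_nonneg (F := F) (B := B) (T := T) hF T
    rw [sum_cePolicy] at h1
    omega
  have sH : ∑ t ∈ Finset.range T, θ t * (cePolicy F B T θ t : ℝ) = ∑ t ∈ H, θ t := by
    rw [hH, Finset.sum_filter]
    refine Finset.sum_congr rfl fun t _ => ?_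
    rcases cePolicy_mem F B T θ t with h | h <;> simp [h]
  -- Equally many low hires `D` and high rejects `E'` are exchanged, so the new set still respects
  -- the budget. Avoiding the gap puts each member of `E'` at c + η or above.
  obtain ⟨D, hDL, hD⟩ := Finset.exists_subset_card_eq (min_le_left L.card E.card)
  obtain ⟨E', hE'E, hE'⟩ := Finset.exists_subset_card_eq (min_le_right L.card E.card)
  have hDH : D ⊆ H := hDL.trans hLH
  have hdisj : Disjoint (H \ D) E' :=
    (hEH.mono_left hE'E).symm.mono_left Finset.sdiff_subset
  have hcard : ((H \ D) ∪ E').card = H.card := by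
    rw [Finset.card_union_of_disjoint hdisj, Finset.card_sdiff_of_subset hDH, hD, hE']
    have := Finset.card_le_card hDH
    omega
  have hmem : (H \ D) ∪ E' ∈ (Finset.range T).powerset.filter (fun S => S.card ≤ B) := by
    rw [Finset.mem_filter, Finset.mem_powerset]
    refine ⟨Finset.union_subset ?_ (hE'E.trans (Finset.filter_subset _ _)), hcard.trans_le cH⟩
    exact Finset.sdiff_subset.trans (Finset.filter_subset _ _)
  refine le_trans ?_ (Finset.le_sup' (fun S => ∑ t ∈ S, θ t) hmem)
  rw [Finset.sum_union hdisj, Finset.sum_sdiff_eq_sub hDH, sH, cL, cE, ← Nat.cast_min]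
  have hDs : ∑ t ∈ D, θ t ≤ (min L.card E.card : ℕ) * c := by
    rw [← hD, ← nsmul_eq_mul]
    refine Finset.sum_le_card_nsmul _ _ _ fun t ht => ?_
    have := hDL ht
    rw [hL, Finset.mem_filter] at this
    exact this.2.1
  have hEs : (min L.card E.card : ℕ) * (c + η) ≤ ∑ t ∈ E', θ t := by
    rw [← hE', ← nsmul_eq_mul]
    refine Finset.card_nsmul_le_sum _ _ _ fun t ht => ?_
    have := hE'E ht
    rw [hE, Finset.mem_filter] at this
    by_contra hlt
    exact hgap t ⟨this.2.1, not_le.1 hlt⟩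
  linarith

lemma measurable_offlineReward (B T : ℕ) : Measurable (offlineReward B T) := by
  have h := Finset.measurable_sup' (s := (Finset.range T).powerset.filter (fun S => S.card ≤ B))
    ⟨∅, by simp⟩ (f := fun S (θ : ℕ → ℝ) => ∑ t ∈ S, θ t)
    (fun S _ => Finset.measurable_sum _ fun t _ => measurable_pi_apply t)
  convert h using 1
  funext θ
  exact (Finset.sup'_apply _ _ _).symm

lemma abs_offlineReward_le {B T : ℕ} {θ : ℕ → ℝ} (hθ : ∀ t, θ t ∈ Set.Icc (0 : ℝ) 1) :
    |offlineReward B T θ| ≤ T := by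
  have h0 : 0 ≤ offlineReward B T θ := by
    refine le_trans ?_ (Finset.le_sup' (fun S => ∑ t ∈ S, θ t) (b := ∅) (by simp))
    simp
  rw [abs_of_nonneg h0]
  refine Finset.sup'_le _ _ fun S hS => ?_
  rw [Finset.mem_filter, Finset.mem_powerset] at hS
  calc ∑ t ∈ S, θ t ≤ ∑ t ∈ Finset.range T, θ t :=
        Finset.sum_le_sum_of_subset_of_nonneg hS.1 fun t _ _ => (hθ t).1
    _ ≤ (Finset.range T).card • (1 : ℝ) := Finset.sum_le_card_nsmul _ _ _ fun t _ => (hθ t).2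
    _ = T := by simp

/-- Across a gap with mass on both sides, some budget makes the regret of the CE policy of order
at least `√T`. -/
lemma exists_budget_regret_cePolicy_ge (ε : ℝ) (hε : 0 < ε) :
    ∃ T₀ : ℕ, ∀ η : ℝ, 0 < η → η < 1 → ∃ C : ℝ, 0 < C ∧
      ∀ (μ : Measure ℝ) [IsProbabilityMeasure μ], (∀ x : ℝ, μ {x} = 0) → μ (Set.Icc 0 1) = 1 →
        (∃ c : ℝ, 0 < c ∧ c < 1 - η ∧
          cdf μ c = Function.leftLim (cdf μ) (c + η) ∧
          ε ≤ min (cdf μ c) (1 - cdf μ (c + η))) →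
        ∀ T : ℕ, T₀ ≤ T → ∃ B : ℕ, 1 ≤ B ∧ B ≤ T ∧
          C * Real.sqrt (T : ℝ) ≤
            regret μ B T (cePolicy (cdf μ) B T) := by
  obtain ⟨T₀, C, hC, main⟩ := exists_budget_min_counts_ge ε hε
  -- The counting bound does not involve the gap length, so `T₀` is independent of η and the
  -- constant is linear in it.
  refine ⟨T₀, fun η hη _ => ⟨η * C, by positivity, ?_⟩⟩
  intro μ _ hμ hsupp ⟨c, _, _, hgap, hmin⟩ T hT
  have mF : Measurable (cdf μ) := (monotone_cdf μ).measurable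
  have h1 : ε ≤ cdf μ c := hmin.trans (min_le_left _ _)
  have h2 : ε ≤ 1 - cdf μ c := by
    have h3 := hmin.trans (min_le_right _ _)
    have := monotone_cdf μ (show c ≤ c + η by linarith)
    linarith
  obtain ⟨B, hB1, hBT, hB⟩ := main μ hμ c h1 h2 T hT
  refine ⟨B, hB1, hBT, ?_⟩
  have hIcc : ∀ᵐ θ ∂(abilityLaw μ), ∀ t, θ t ∈ Set.Icc (0 : ℝ) 1 :=
    ae_abilityLaw_forall ((mem_ae_iff_prob_eq_one measurableSet_Icc).2 hsupp)
  have iOff : Integrable (offlineReward B T) (abilityLaw μ) :=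
    Integrable.of_bound (measurable_offlineReward B T).aestronglyMeasurable T
      (hIcc.mono fun θ hθ => abs_offlineReward_le hθ)
  have iPol : Integrable (fun θ => ∑ t ∈ Finset.range T, θ t * (cePolicy (cdf μ) B T θ t : ℝ))
      (abilityLaw μ) := by
    refine integrable_finsetSum _ fun t _ => Integrable.of_bound
      ((measurable_pi_apply t).mul
        (measurable_intCast_comp (measurable_cePolicy mF B T t))).aestronglyMeasurable 1
      (hIcc.mono fun θ hθ => ?_)
    rw [Real.norm_eq_abs, abs_le]
    rcases cePolicy_mem (cdf μ) B T θ t with h | h <;> rw [h] <;> constructor <;>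
      simp <;> linarith [(hθ t).1, (hθ t).2]
  have bmin := (bddMeas_lowHireCount mF c B T T).min (bddMeas_highRejectCount mF c B T T)
  have iMin := (bmin.const_mul η).integrable (abilityLaw μ)
  have path := integral_mono_ae (iPol.add iMin) iOff (by
    filter_upwards [ae_abilityLaw_forall (ae_cdf_lt_one hμ),
      ae_abilityLaw_forall (ae_notMem_gap hgap)] with θ hθ1 hθ2
    exact cePolicy_add_gap_le_offlineReward hθ1 hθ2)
  have split := integral_add iPol iMin
  rw [integral_const_mul] at split
  have hle := mul_le_mul_of_nonneg_left hB hη.le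
  unfold regret offlineValue policyValue
  simp only [Pi.add_apply] at path
  linarith

end MultiSecretary

theorem theorem1 (ε : ℝ) (hε : 0 < ε) (hε' : ε ≤ 1 / 2) :
    ∃ T₀ : ℕ, ∀ η : ℝ, 0 < η → η < 1 → ∃ C : ℝ, 0 < C ∧
      ∀ (μ : Measure ℝ) [IsProbabilityMeasure μ], (∀ x : ℝ, μ {x} = 0) → μ (Set.Icc 0 1) = 1 →
        (∃ c : ℝ, 0 < c ∧ c < 1 - η ∧
          cdf μ c = Function.leftLim (cdf μ) (c + η) ∧
          ε ≤ min (cdf μ c) (1 - cdf μ (c + η))) →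
        ∀ T : ℕ, T₀ ≤ T → ∃ B : ℕ, 1 ≤ B ∧ B ≤ T ∧
          C * Real.sqrt (T : ℝ) ≤
            MultiSecretary.regret μ B T (MultiSecretary.cePolicy (cdf μ) B T) :=
  MultiSecretary.exists_budget_regret_cePolicy_ge ε hε
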